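/- Let $q\in\mathbb C\setminus\{0\}$ and fix a square root $q^{1/2}$. All algebras are over $\mathbb C$ and $\mathbb Z_2$-graded with grade $p$; $\tau(a)=(-1)^{p(a)}a$; tensor products of superalgebras carry the product $(a_1\otimes b_1)(a_2\otimes b_2)=(-1)^{p(b_1)p(a_2)}a_1a_2\otimes b_1b_2$. Let $\mathcal X=\mathcal O(SP_q^{1|2})$ be the superalgebra with even generator $x$, odd generators $\xi,\eta$ and relations $$x\xi=q\,\xi x,\quad x\eta=q^{-1}\eta x,\quad \eta\xi=-q^2\xi\eta+q^{1/2}(1-q)x^2,\quad \xi^2=\eta^2=0.$$ Let $\mathcal A=\mathcal O(SP_q(1|2))$ be the superalgebra with even generators $a,b,c,d$, odd generators $\alpha,\delta$ and relations $$\begin{aligned} &ab=q^2ba,\quad ac=q^2ca,\quad a\alpha=q\alpha a,\quad a\delta=q\delta a+(q-q^{-1})\alpha c,\\ &ad=da+(q-q^{-1})[(1+q^{-1})bc+q^{-1/2}\alpha\delta],\quad bc=cb,\quad bd=q^2db,\quad b\alpha=q^{-1}\alpha b,\quad b\delta=q\delta b,\\ &cd=q^2dc,\quad c\alpha=q^{-1}\alpha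 c,\quad c\delta=q\delta c,\quad d\alpha=q^{-1}\alpha d+(q^{-1}-q)\delta b,\quad d\delta=q^{-1}\delta d,\\ &\alpha\delta=-q\delta\alpha+q^{1/2}(q-q^{-1})bc,\quad \alpha^2=q^{1/2}(q-1)ba,\quad \delta^2=q^{1/2}(q-1)dc,\\ &ad-qbc-q^{1/2}\alpha\delta=1 . \end{aligned}$$ Put $\gamma=q^{-1/2}a\delta-q^{3/2}c\alpha$, $\beta=q^{1/2}b\delta-q^{-1/2}\alpha d$, $e=1+q^{1/2}\delta\alpha+(q^{-1}-1)bc$ and $$T=(t_{ij})=\begin{pmatrix}a&\alpha&b\\ \gamma&e&\beta\\ c&\delta&d\end{pmatrix},\qquad T^{-1}=\begin{pmatrix} d & q^{-1/2}\beta & -q^{-1}b \\ -q^{1/2}\delta & e & q^{-1/2}\alpha \\ -qc & -q^{1/2}\gamma & a \end{pmatrix}.$$ Then $\mathcal A$ is a super-Hopf algebra with $\Delta(t_{ij})=\sum_k t_{ik}\otimes t_{kj}$, $\epsilon(t_{ij})=\delta_{ij}$, $S(T)=T^{-1}$, and $\mathcal X$ is a left quantum space for $\mathcal A$ with coaction $\delta_L(X_i)=\sum_k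 t_{ik}\otimes X_k$, where $(X_1,X_2,X_3)=(\xi,x,\eta)$. A $\mathbb Z_2$-graded first-order differential calculus over $\mathcal X$ is a graded $\mathcal X$-bimodule $\Gamma$ with an odd linear map $\mathsf d:\mathcal X\to\Gamma$ such that $\mathsf d(fg)=(\mathsf df)g+(-1)^{p(f)}f\,\mathsf dg$ and $\Gamma$ is spanned by the elements $f\,(\mathsf dg)\,h$. It is left covariant if there is a left coaction $\Delta_L$ of $\mathcal A$ on the superalgebra $\mathcal X\oplus\Gamma$ (with $\Gamma\cdot\Gamma=0$), an algebra homomorphism into $\mathcal A\otimes(\mathcal X\oplus\Gamma)$, with $\Delta_L(u)=\delta_L(u)$ and $\Delta_L(\mathsf du)=(\tau\otimes\mathsf d)\delta_L(u)$ for $u\in\mathcal X$. Consider the relations of the first calculus $\Gamma_+$: $$\begin{aligned} x\,\mathsf dx&=q\,\mathsf dx\,x+q^{1/2}(q^2-1)\,\mathsf d\eta\,\xi, & x\,\mathsf d\xi&=q\,\mathsf d\xi\,x+(q^2-1)\,\mathsf dx\,\xi, & x\,\mathsf d\eta&=q\,\mathsf d\eta\,x,\\ \xi\,\mathsf dx&=-q\,\mathsf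 dx\,\xi, & \xi\,\mathsf d\xi&=\mathsf d\xi\,\xi, & \xi\,\mathsf d\eta&=q^2\,\mathsf d\eta\,\xi,\\ \eta\,\mathsf dx&=-q\,\mathsf dx\,\eta+(1-q^2)\,\mathsf d\eta\,x, & \eta\,\mathsf d\eta&=\mathsf d\eta\,\eta,\\ \eta\,\mathsf d\xi&=q^2\,\mathsf d\xi\,\eta+(1-q^2)[(1+q)\,\mathsf d\eta\,\xi-q^{1/2}\,\mathsf dx\,x]. & & \end{aligned}\tag{13}$$ There exists a second left covariant $\mathbb Z_2$-graded first-order differential calculus $\Gamma_-$ over $\mathcal X$ with respect to $\mathcal A$ such that $\{\mathsf dx,\mathsf d\xi,\mathsf d\eta\}$ is a free right $\mathcal X$-module basis of $\Gamma_-$ and whose commutation relations are those obtained from (13) by replacing $q\to q^{-1}$ (and $q^{1/2}\to q^{-1/2}$), $x\to\sqrt{-1}\,x$, $\xi\leftrightarrow\eta$, $\mathsf dx\to\sqrt{-1}\,\mathsf dx$, $\mathsf d\xi\leftrightarrow\mathsf d\eta$. If $q^2\neq1$, then $\Gamma_-$ does not satisfy (13), so it is different from $\Gamma_+$ (for $q^2=1$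 the two systems of relations coincide). -/

import Mathlib

open scoped TensorProduct RightActions

noncomputable section

/-! ### Superalgebras over `ℂ` -/

/-- A superalgebra (`ℤ/2`-graded algebra) over `ℂ`. The grading is recorded by the grading
automorphism `τ(a) = (-1)^{p(a)} a`: an algebra endomorphism with `τ ∘ τ = id`. The homogeneous
components are its eigenspaces, see `homog` below. -/
class SuperAlgebra (A : Type*) [Ring A] [Algebra ℂ A] where
  /-- the grading automorphism `a ↦ (-1)^{p(a)} a` -/
  parity : A →ₐ[ℂ] A
  parity_parity : ∀ a, parity (parity a) = a

open SuperAlgebra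

/-- The homogeneous component of degree `i` of a superalgebra. -/
def homog (A : Type*) [Ring A] [Algebra ℂ A] [SuperAlgebra A] (i : ZMod 2) : Submodule ℂ A where
  carrier := {a | parity a = (-1 : ℂ) ^ i.val • a}
  add_mem' := by
    intro a b ha hb
    change parity (a + b) = _
    rw [map_add, show parity a = _ from ha, show parity b = _ from hb, smul_add]
  zero_mem' := by simp
  smul_mem' := by
    intro c a ha
    change parity (c • a) = _
    rw [map_smul, show parity a = _ from ha, smul_comm]

theorem mem_homog_zero {A : Type*} [Ring A] [Algebra ℂ A] [SuperAlgebra A] {a : A} :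
    a ∈ homog A 0 ↔ parity a = a := by
  change parity a = (-1 : ℂ) ^ (0 : ZMod 2).val • a ↔ _
  simp

theorem mem_homog_one {A : Type*} [Ring A] [Algebra ℂ A] [SuperAlgebra A] {a : A} :
    a ∈ homog A 1 ↔ parity a = -a := by
  change parity a = (-1 : ℂ) ^ (1 : ZMod 2).val • a ↔ _
  simp [ZMod.val_one]

/-- The projection of a superalgebra onto its even part. -/
def evenPart (A : Type*) [Ring A] [Algebra ℂ A] [SuperAlgebra A] : A →ₗ[ℂ] homog A 0 :=
  LinearMap.codRestrict (homog A 0) ((2⁻¹ : ℂ) • (LinearMap.id + (parity (A := A)).toLinearMap))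
    fun a => by
      change (2⁻¹ : ℂ) • (a + parity a) ∈ _
      rw [mem_homog_zero, map_smul, map_add, parity_parity, add_comm]

/-- The projection of a superalgebra onto its odd part. -/
def oddPart (A : Type*) [Ring A] [Algebra ℂ A] [SuperAlgebra A] : A →ₗ[ℂ] homog A 1 :=
  LinearMap.codRestrict (homog A 1) ((2⁻¹ : ℂ) • (LinearMap.id - (parity (A := A)).toLinearMap))
    fun a => by
      change (2⁻¹ : ℂ) • (a - parity a) ∈ _
      rw [mem_homog_one, map_smul, map_sub, parity_parity, ← smul_neg, neg_sub]

/-- The homogeneous components of a superalgebra form a `ℤ/2`-grading. -/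
instance homogGradedAlgebra (A : Type*) [Ring A] [Algebra ℂ A] [SuperAlgebra A] :
    GradedAlgebra (homog A) where
  one_mem := by rw [mem_homog_zero, map_one]
  mul_mem := by
    intro i j a b ha hb
    fin_cases i <;> fin_cases j
    · change a ∈ homog A 0 at ha
      change b ∈ homog A 0 at hb
      change a * b ∈ homog A 0
      rw [mem_homog_zero] at *
      rw [map_mul, ha, hb]
    · change a ∈ homog A 0 at ha
      change b ∈ homog A 1 at hb
      change a * b ∈ homog A 1
      rw [mem_homog_zero] at ha
      rw [mem_homog_one] at *
      rw [map_mul, ha, hb, mul_neg]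
    · change a ∈ homog A 1 at ha
      change b ∈ homog A 0 at hb
      change a * b ∈ homog A 1
      rw [mem_homog_zero] at hb
      rw [mem_homog_one] at *
      rw [map_mul, ha, hb, neg_mul]
    · change a ∈ homog A 1 at ha
      change b ∈ homog A 1 at hb
      change a * b ∈ homog A 0
      rw [mem_homog_zero]
      rw [mem_homog_one] at *
      rw [map_mul, ha, hb, neg_mul_neg]
  toDecomposition := DirectSum.Decomposition.ofLinearMap (homog A)
    (DirectSum.lof ℂ (ZMod 2) (fun i => homog A i) 0 ∘ₗ evenPart A +
      DirectSum.lof ℂ (ZMod 2) (fun i => homog A i) 1 ∘ₗ oddPart A)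
    (by
      ext a
      simp only [LinearMap.comp_apply, LinearMap.add_apply, map_add, DirectSum.coeLinearMap_lof,
        LinearMap.id_apply]
      change (2⁻¹ : ℂ) • (a + parity a) + (2⁻¹ : ℂ) • (a - parity a) = a
      rw [← smul_add, add_add_sub_cancel, ← two_smul ℂ a, smul_smul]
      norm_num)
    (by
      refine DirectSum.linearMap_ext ℂ fun i => LinearMap.ext fun a => ?_
      obtain ⟨a, ha⟩ := a
      simp only [LinearMap.comp_apply, LinearMap.add_apply, DirectSum.coeLinearMap_lof,
        LinearMap.id_apply]
      fin_cases i
      · change a ∈ homog A 0 at ha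
        have h0 : evenPart A a = ⟨a, ha⟩ := by
          ext
          change (2⁻¹ : ℂ) • (a + parity a) = a
          rw [mem_homog_zero.1 ha, ← two_smul ℂ a, smul_smul]
          norm_num
        have h1 : oddPart A a = 0 := by
          ext
          change (2⁻¹ : ℂ) • (a - parity a) = 0
          rw [mem_homog_zero.1 ha, sub_self, smul_zero]
        rw [h0, h1, map_zero, add_zero]
        rfl
      · change a ∈ homog A 1 at ha
        have h0 : evenPart A a = 0 := by
          ext
          change (2⁻¹ : ℂ) • (a + parity a) = 0
          rw [mem_homog_one.1 ha, add_neg_cancel, smul_zero]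
        have h1 : oddPart A a = ⟨a, ha⟩ := by
          ext
          change (2⁻¹ : ℂ) • (a - parity a) = a
          rw [mem_homog_one.1 ha, sub_neg_eq_add, ← two_smul ℂ a, smul_smul]
          norm_num
        rw [h0, h1, map_zero, zero_add]
        rfl)

/-- The superalgebra tensor product `A ⊗ B`, with product
`(a₁ ⊗ b₁)(a₂ ⊗ b₂) = (-1)^{p(b₁) p(a₂)} a₁a₂ ⊗ b₁b₂` on homogeneous elements. -/
abbrev SuperTensor (A B : Type*) [Ring A] [Algebra ℂ A] [SuperAlgebra A]
    [Ring B] [Algebra ℂ B] [SuperAlgebra B] : Type _ :=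
  homog A ᵍ⊗[ℂ] homog B

/-- The identification of vector spaces `A ⊗ B = A ⊗[ℂ] B` (which forgets the product). -/
abbrev superOf (A B : Type*) [Ring A] [Algebra ℂ A] [SuperAlgebra A]
    [Ring B] [Algebra ℂ B] [SuperAlgebra B] : A ⊗[ℂ] B ≃ₗ[ℂ] SuperTensor A B :=
  GradedTensorProduct.of ℂ (homog A) (homog B)

/-! ### Super-Hopf algebras and left quantum spaces -/

/-- A super-Hopf algebra structure on the superalgebra `A`: a (graded) coalgebra structure for which
`Δ : A → A ⊗ A` (super tensor product) and `ε` are algebra homomorphisms, and an antipode. -/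
structure SuperHopfAlgebra (A : Type*) [Ring A] [Algebra ℂ A] [SuperAlgebra A]
    extends Coalgebra ℂ A where
  comul_one : superOf A A (comul 1) = 1
  comul_mul : ∀ a b : A, superOf A A (comul (a * b)) = superOf A A (comul a) * superOf A A (comul b)
  comul_parity : ∀ a : A, comul (parity a) =
    TensorProduct.map (parity (A := A)).toLinearMap (parity (A := A)).toLinearMap (comul a)
  counit_one : counit 1 = 1
  counit_mul : ∀ a b : A, counit (a * b) = counit a * counit b
  counit_parity : ∀ a : A, counit (parity a) = counit a
  /-- the antipode -/
  antipode : A →ₗ[ℂ] A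
  antipode_parity : ∀ a : A, antipode (parity a) = parity (antipode a)
  antipode_left : ∀ a : A,
    LinearMap.mul' ℂ A (TensorProduct.map antipode LinearMap.id (comul a)) =
      algebraMap ℂ A (counit a)
  antipode_right : ∀ a : A,
    LinearMap.mul' ℂ A (TensorProduct.map LinearMap.id antipode (comul a)) =
      algebraMap ℂ A (counit a)

/-- A structure of left quantum space for the super-Hopf algebra `H` (with underlying superalgebra
`A`) on the superalgebra `X`: a grade-preserving algebra homomorphism `δ : X → A ⊗ X` with
`(id ⊗ δ) ∘ δ = (Δ ⊗ id) ∘ δ` and `(ε ⊗ id) ∘ δ = id`. -/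
structure LeftQuantumSpace {A : Type*} [Ring A] [Algebra ℂ A] [SuperAlgebra A]
    (H : SuperHopfAlgebra A) (X : Type*) [Ring X] [Algebra ℂ X] [SuperAlgebra X] where
  /-- the left coaction -/
  coact : X →ₐ[ℂ] SuperTensor A X
  coact_parity : ∀ u : X, (superOf A X).symm (coact (parity u)) =
    TensorProduct.map (parity (A := A)).toLinearMap (parity (A := X)).toLinearMap
      ((superOf A X).symm (coact u))
  coassoc : ∀ u : X,
    TensorProduct.map LinearMap.id ((superOf A X).symm.toLinearMap ∘ₗ coact.toLinearMap)
        ((superOf A X).symm (coact u)) =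
      TensorProduct.assoc ℂ A A X
        (TensorProduct.map H.comul LinearMap.id ((superOf A X).symm (coact u)))
  counit_coact : ∀ u : X,
    TensorProduct.lid ℂ X
      (TensorProduct.map H.counit LinearMap.id ((superOf A X).symm (coact u))) = u

/-! ### First-order differential calculi -/

/-- A `ℤ/2`-graded first-order differential calculus over the superalgebra `X`: a graded bimodule
`Γ` over `X` (left action `u •> ω`, right action `ω <• u`) and an odd linear map `d : X → Γ` with
`d(fg) = (df) g + (-1)^{p(f)} f (dg)` such that `Γ` is spanned by the elements `a (db) c`. The grading
of `Γ` is recorded by the map `ω ↦ (-1)^{p(ω)} ω`. -/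
structure SuperCalculus (X : Type) [Ring X] [Algebra ℂ X] [SuperAlgebra X] where
  /-- the bimodule of one-forms -/
  Form : Type
  [addCommGroup : AddCommGroup Form]
  [moduleComplex : Module ℂ Form]
  [moduleLeft : Module X Form]
  [moduleRight : Module Xᵐᵒᵖ Form]
  [smulCommClass : SMulCommClass X Xᵐᵒᵖ Form]
  [towerLeft : IsScalarTower ℂ X Form]
  [towerRight : IsScalarTower ℂ Xᵐᵒᵖ Form]
  /-- `ω ↦ (-1)^{p(ω)} ω` -/
  formParity : Form →ₗ[ℂ] Form
  formParity_formParity : ∀ ω, formParity (formParity ω) = ω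
  formParity_left : ∀ (u : X) (ω : Form), formParity (u •> ω) = parity u •> formParity ω
  formParity_right : ∀ (u : X) (ω : Form), formParity (ω <• u) = formParity ω <• parity u
  /-- the differential -/
  d : X →ₗ[ℂ] Form
  formParity_d : ∀ f, formParity (d f) = -d (parity f)
  leibniz : ∀ f g : X, d (f * g) = d f <• g + parity f •> d g
  span_eq_top : Submodule.span ℂ {ω : Form | ∃ a b c : X, ω = (a •> d b) <• c} = ⊤

attribute [instance] SuperCalculus.addCommGroup SuperCalculus.moduleComplex
  SuperCalculus.moduleLeft SuperCalculus.moduleRight SuperCalculus.smulCommClass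
  SuperCalculus.towerLeft SuperCalculus.towerRight

namespace SuperCalculus

variable {X : Type} [Ring X] [Algebra ℂ X] [SuperAlgebra X]

/-- The algebra `X ⊕ Γ` of functions and one-forms, in which products of two one-forms vanish. -/
abbrev Total (Γ : SuperCalculus X) : Type := TrivSqZeroExt X Γ.Form

/-- `X ⊕ Γ` is a superalgebra. -/
instance (Γ : SuperCalculus X) : SuperAlgebra Γ.Total where
  parity := AlgHom.ofLinearMap
    { toFun := fun w => TrivSqZeroExt.inl (parity w.fst) + TrivSqZeroExt.inr (Γ.formParity w.snd)
      map_add' := by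
        intro v w
        ext <;> simp
      map_smul' := by
        intro c w
        ext <;> simp }
    (by ext <;> simp)
    (by
      intro v w
      ext <;> simp [Γ.formParity_left, Γ.formParity_right])
  parity_parity := by
    intro w
    ext <;> simp [parity_parity, Γ.formParity_formParity]

/-- The inclusion of `X` into `X ⊕ Γ`. -/
def inX (Γ : SuperCalculus X) : X →ₗ[ℂ] Γ.Total where
  toFun := TrivSqZeroExt.inl
  map_add' := TrivSqZeroExt.inl_add _
  map_smul' := fun c u => TrivSqZeroExt.inl_smul _ c u

/-- The differential, with values in `X ⊕ Γ`. -/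
def dTotal (Γ : SuperCalculus X) : X →ₗ[ℂ] Γ.Total where
  toFun := fun u => TrivSqZeroExt.inr (Γ.d u)
  map_add' := by intro u v; rw [map_add, TrivSqZeroExt.inr_add]
  map_smul' := by intro c u; rw [map_smul, TrivSqZeroExt.inr_smul]; rfl

variable {A : Type*} [Ring A] [Algebra ℂ A] [SuperAlgebra A] {H : SuperHopfAlgebra A}

/-- Left covariance of a calculus over a left quantum space `X` with coaction `δ`: there is a left
coaction `Δ` of `H` on functions and one-forms, an algebra homomorphism, with `Δ(u) = δ(u)` and
`Δ(du) = (τ ⊗ d)(δ(u))` for `u` in `X`, where `τ(a) = (-1)^{p(a)} a` on `A`. -/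
def IsLeftCovariant (Γ : SuperCalculus X) (δ : LeftQuantumSpace H X) : Prop :=
  ∃ Δ : LeftQuantumSpace H Γ.Total,
    (∀ u : X, Δ.coact (Γ.inX u) = superOf A Γ.Total
      (TensorProduct.map LinearMap.id Γ.inX ((superOf A X).symm (δ.coact u)))) ∧
    (∀ u : X, Δ.coact (Γ.dTotal u) = superOf A Γ.Total
      (TensorProduct.map (parity (A := A)).toLinearMap Γ.dTotal ((superOf A X).symm (δ.coact u))))

end SuperCalculus

/-! ### The quantum symplectic superspace `SP_q^{1|2}`

Throughout, `q` is the deformation parameter and `r` is a chosen square root `q^{1/2}`. -/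

namespace SP

/-- The generators `ξ, x, η` of the free algebra. -/
abbrev gen (i : Fin 3) : FreeAlgebra ℂ (Fin 3) := FreeAlgebra.ι ℂ i

/-- Defining relations; the generators are numbered `ξ = gen 0`, `x = gen 1`, `η = gen 2`. -/
inductive Rel (q r : ℂ) : FreeAlgebra ℂ (Fin 3) → FreeAlgebra ℂ (Fin 3) → Prop
  | x_xi : Rel q r (gen 1 * gen 0) (q • (gen 0 * gen 1))
  | x_eta : Rel q r (gen 1 * gen 2) (q⁻¹ • (gen 2 * gen 1))
  | eta_xi : Rel q r (gen 2 * gen 0)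
      (-(q ^ 2 • (gen 0 * gen 2)) + (r * (1 - q)) • (gen 1 * gen 1))
  | xi_xi : Rel q r (gen 0 * gen 0) 0
  | eta_eta : Rel q r (gen 2 * gen 2) 0

/-- The algebra `O(SP_q^{1|2})` of polynomials on the quantum symplectic superspace. -/
def Alg (q r : ℂ) : Type := RingQuot (Rel q r)

instance (q r : ℂ) : Ring (Alg q r) := inferInstanceAs (Ring (RingQuot (Rel q r)))

instance (q r : ℂ) : Algebra ℂ (Alg q r) := inferInstanceAs (Algebra ℂ (RingQuot (Rel q r)))

/-- The quotient map from the free algebra. -/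
def mk (q r : ℂ) : FreeAlgebra ℂ (Fin 3) →ₐ[ℂ] Alg q r := RingQuot.mkAlgHom ℂ (Rel q r)

/-- The coordinates `X_0 = ξ`, `X_1 = x`, `X_2 = η`. -/
def coord (q r : ℂ) (i : Fin 3) : Alg q r := mk q r (gen i)

/-- The signs `(-1)^{p(X_i)}`: `ξ, η` are odd and `x` is even. -/
def sign : Fin 3 → ℂ := ![-1, 1, -1]

theorem mk_rel (q r : ℂ) {u v : FreeAlgebra ℂ (Fin 3)} (h : Rel q r u v) : mk q r u = mk q r v :=
  RingQuot.mkAlgHom_rel ℂ h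

/-- The grading automorphism on the free algebra, with values in the quotient. -/
def preParity (q r : ℂ) : FreeAlgebra ℂ (Fin 3) →ₐ[ℂ] Alg q r :=
  FreeAlgebra.lift ℂ fun i => sign i • coord q r i

theorem preParity_rel (q r : ℂ) {u v : FreeAlgebra ℂ (Fin 3)} (h : Rel q r u v) :
    preParity q r u = preParity q r v := by
  have key := mk_rel q r h
  cases h <;>
    simp only [preParity, gen, map_add, map_neg, map_mul, map_smul, map_zero, FreeAlgebra.lift_ι_apply,
      sign, coord, Matrix.cons_val_zero, Matrix.cons_val_one, Matrix.cons_val, one_smul,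
      neg_smul, mul_neg, neg_mul, neg_neg] at key ⊢ <;>
    first
      | exact key
      | (rw [key]; simp only [smul_neg])

/-- Algebra homomorphisms on the quotient are determined by their values on the generators. -/
theorem algHom_ext {q r : ℂ} {B : Type*} [Ring B] [Algebra ℂ B] {f g : Alg q r →ₐ[ℂ] B}
    (h : ∀ i, f (coord q r i) = g (coord q r i)) : f = g :=
  RingQuot.ringQuot_ext' ℂ f g (FreeAlgebra.hom_ext (funext h))

/-- The grading automorphism. -/
def parityHom (q r : ℂ) : Alg q r →ₐ[ℂ] Alg q r :=
  RingQuot.liftAlgHom ℂ ⟨preParity q r, fun _ _ h => preParity_rel q r h⟩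

theorem parityHom_coord (q r : ℂ) (i : Fin 3) : parityHom q r (coord q r i) = sign i • coord q r i :=
  (RingQuot.liftAlgHom_mkAlgHom_apply ℂ _ _ _).trans
    (by rw [preParity, FreeAlgebra.lift_ι_apply])

/-- `O(SP_q^{1|2})` is a superalgebra with `x` even and `ξ, η` odd. -/
instance (q r : ℂ) : SuperAlgebra (Alg q r) where
  parity := parityHom q r
  parity_parity := by
    have h : (parityHom q r).comp (parityHom q r) = AlgHom.id ℂ _ := by
      refine algHom_ext fun i => ?_
      rw [AlgHom.comp_apply, parityHom_coord, map_smul, parityHom_coord, smul_smul]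
      fin_cases i <;> simp [sign]
    exact DFunLike.congr_fun h


end SP

/-! ### The quantum supergroup `SP_q(1|2)` -/

namespace OSP

/-- The six generators. -/
inductive Gen : Type
  | a | b | c | d | α | δ

/-- Abbreviation for a generator of the free algebra. -/
abbrev gen (g : Gen) : FreeAlgebra ℂ Gen := FreeAlgebra.ι ℂ g

open Gen in
/-- Defining relations: the commutation relations of the generators, and `D_q = 1`. -/
inductive Rel (q r : ℂ) : FreeAlgebra ℂ Gen → FreeAlgebra ℂ Gen → Prop
  | ab : Rel q r (gen a * gen b) (q ^ 2 • (gen b * gen a))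
  | ac : Rel q r (gen a * gen c) (q ^ 2 • (gen c * gen a))
  | aα : Rel q r (gen a * gen α) (q • (gen α * gen a))
  | aδ : Rel q r (gen a * gen δ) (q • (gen δ * gen a) + (q - q⁻¹) • (gen α * gen c))
  | ad : Rel q r (gen a * gen d) (gen d * gen a
      + (q - q⁻¹) • ((1 + q⁻¹) • (gen b * gen c) + r⁻¹ • (gen α * gen δ)))
  | bc : Rel q r (gen b * gen c) (gen c * gen b)
  | bd : Rel q r (gen b * gen d) (q ^ 2 • (gen d * gen b))
  | bα : Rel q r (gen b * gen α) (q⁻¹ • (gen α * gen b))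
  | bδ : Rel q r (gen b * gen δ) (q • (gen δ * gen b))
  | cd : Rel q r (gen c * gen d) (q ^ 2 • (gen d * gen c))
  | cα : Rel q r (gen c * gen α) (q⁻¹ • (gen α * gen c))
  | cδ : Rel q r (gen c * gen δ) (q • (gen δ * gen c))
  | dα : Rel q r (gen d * gen α) (q⁻¹ • (gen α * gen d) + (q⁻¹ - q) • (gen δ * gen b))
  | dδ : Rel q r (gen d * gen δ) (q⁻¹ • (gen δ * gen d))
  | αδ : Rel q r (gen α * gen δ) (-(q • (gen δ * gen α)) + (r * (q - q⁻¹)) • (gen b * gen c))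
  | αα : Rel q r (gen α * gen α) ((r * (q - 1)) • (gen b * gen a))
  | δδ : Rel q r (gen δ * gen δ) ((r * (q - 1)) • (gen d * gen c))
  | superdet : Rel q r (gen a * gen d - q • (gen b * gen c) - r • (gen α * gen δ)) 1

/-- The algebra `O(SP_q(1|2))`. -/
def Alg (q r : ℂ) : Type := RingQuot (Rel q r)

instance (q r : ℂ) : Ring (Alg q r) := inferInstanceAs (Ring (RingQuot (Rel q r)))

instance (q r : ℂ) : Algebra ℂ (Alg q r) := inferInstanceAs (Algebra ℂ (RingQuot (Rel q r)))

/-- The quotient map from the free algebra. -/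
def mk (q r : ℂ) : FreeAlgebra ℂ Gen →ₐ[ℂ] Alg q r := RingQuot.mkAlgHom ℂ (Rel q r)

/-- The generators of `O(SP_q(1|2))`. -/
def elt (q r : ℂ) (g : Gen) : Alg q r := mk q r (gen g)

/-- The signs `(-1)^{p(g)}`: `α, δ` are odd and `a, b, c, d` are even. -/
def sign : Gen → ℂ
  | .a => 1
  | .b => 1
  | .c => 1
  | .d => 1
  | .α => -1
  | .δ => -1

theorem mk_rel (q r : ℂ) {u v : FreeAlgebra ℂ Gen} (h : Rel q r u v) : mk q r u = mk q r v :=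
  RingQuot.mkAlgHom_rel ℂ h

/-- The grading automorphism on the free algebra, with values in the quotient. -/
def preParity (q r : ℂ) : FreeAlgebra ℂ Gen →ₐ[ℂ] Alg q r :=
  FreeAlgebra.lift ℂ fun g => sign g • elt q r g

theorem preParity_rel (q r : ℂ) {u v : FreeAlgebra ℂ Gen} (h : Rel q r u v) :
    preParity q r u = preParity q r v := by
  have key := mk_rel q r h
  cases h <;>
    simp only [preParity, gen, map_add, map_sub, map_neg, map_mul, map_smul, map_one,
      FreeAlgebra.lift_ι_apply, sign, elt, one_smul, neg_smul, mul_neg, neg_mul, neg_neg]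
      at key ⊢ <;>
    first
      | exact key
      | (rw [key]; simp only [smul_neg, neg_add])

/-- Algebra homomorphisms on the quotient are determined by their values on the generators. -/
theorem algHom_ext {q r : ℂ} {B : Type*} [Ring B] [Algebra ℂ B] {f g : Alg q r →ₐ[ℂ] B}
    (h : ∀ i, f (elt q r i) = g (elt q r i)) : f = g :=
  RingQuot.ringQuot_ext' ℂ f g (FreeAlgebra.hom_ext (funext h))

/-- The grading automorphism. -/
def parityHom (q r : ℂ) : Alg q r →ₐ[ℂ] Alg q r :=
  RingQuot.liftAlgHom ℂ ⟨preParity q r, fun _ _ h => preParity_rel q r h⟩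

theorem parityHom_elt (q r : ℂ) (i : Gen) : parityHom q r (elt q r i) = sign i • elt q r i :=
  (RingQuot.liftAlgHom_mkAlgHom_apply ℂ _ _ _).trans
    (by rw [preParity, FreeAlgebra.lift_ι_apply])

/-- `O(SP_q(1|2))` is a superalgebra with `a, b, c, d` even and `α, δ` odd. -/
instance (q r : ℂ) : SuperAlgebra (Alg q r) where
  parity := parityHom q r
  parity_parity := by
    have h : (parityHom q r).comp (parityHom q r) = AlgHom.id ℂ _ := by
      refine algHom_ext fun i => ?_
      rw [AlgHom.comp_apply, parityHom_elt, map_smul, parityHom_elt, smul_smul]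
      cases i <;> simp [sign]
    exact DFunLike.congr_fun h

variable (q r : ℂ)

/-- The matrix entry `γ`. -/
def γ : Alg q r := r⁻¹ • (elt q r .a * elt q r .δ) - r ^ 3 • (elt q r .c * elt q r .α)

/-- The matrix entry `β`. -/
def β : Alg q r := r • (elt q r .b * elt q r .δ) - r⁻¹ • (elt q r .α * elt q r .d)

/-- The matrix entry `e`. -/
def e : Alg q r := 1 + r • (elt q r .δ * elt q r .α) + (q⁻¹ - 1) • (elt q r .b * elt q r .c)

/-- The quantum supermatrix `T = (t_ij)`. Its entries `γ, e, β` are those for which the quantum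
orthosymplectic condition holds, that is, `T T⁻¹ = T⁻¹ T = 1` with the matrix `Tinv` below, and for
which `e ↦ 1`, `γ, β ↦ 0` under the counit. -/
def T : Matrix (Fin 3) (Fin 3) (Alg q r) :=
  !![elt q r .a, elt q r .α, elt q r .b;
     γ q r, e q r, β q r;
     elt q r .c, elt q r .δ, elt q r .d]

/-- The inverse matrix `T⁻¹ = C_q⁻¹ T^{st} C_q`. -/
def Tinv : Matrix (Fin 3) (Fin 3) (Alg q r) :=
  !![elt q r .d, r⁻¹ • β q r, -(q⁻¹ • elt q r .b);
     -(r • elt q r .δ), e q r, r⁻¹ • elt q r .α;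
     -(q • elt q r .c), -(r • γ q r), elt q r .a]

variable {q r}

/-- `H` is the standard super-Hopf structure on `O(SP_q(1|2))`:
`Δ(t_ij) = ∑ₖ t_ik ⊗ t_kj`, `ε(t_ij) = δ_ij`, `S(T) = T⁻¹`. -/
def IsStandard (H : SuperHopfAlgebra (Alg q r)) : Prop :=
  (∀ i j, H.comul (T q r i j) = ∑ k, T q r i k ⊗ₜ[ℂ] T q r k j) ∧
  (∀ i j, H.counit (T q r i j) = if i = j then 1 else 0) ∧
  (∀ i j, H.antipode (T q r i j) = Tinv q r i j)

/-- `δ` is the standard left coaction `δ(X_i) = ∑ₖ t_ik ⊗ X_k` on `O(SP_q^{1|2})`. -/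
def IsStandardCoaction {H : SuperHopfAlgebra (Alg q r)} (δ : LeftQuantumSpace H (SP.Alg q r)) :
    Prop :=
  ∀ i, δ.coact (SP.coord q r i) =
    superOf (Alg q r) (SP.Alg q r) (∑ k, T q r i k ⊗ₜ[ℂ] SP.coord q r k)

end OSP

/-- The nine commutation relations between elements `x, ξ, η` of an algebra and elements
`dx, dξ, dη` of a bimodule over it, for the parameter `q` with square root `r`; for the coordinates
and their differentials these are the relations of the first calculus `Γ₊`. -/
def CalculusRelations {X Γ : Type*} [Ring X] [AddCommGroup Γ] [Module ℂ Γ] [Module X Γ]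
    [Module Xᵐᵒᵖ Γ] (q r : ℂ) (x ξ η : X) (dx dξ dη : Γ) : Prop :=
  x •> dx = q • (dx <• x) + (r * (q ^ 2 - 1)) • (dη <• ξ) ∧
  x •> dξ = q • (dξ <• x) + (q ^ 2 - 1) • (dx <• ξ) ∧
  x •> dη = q • (dη <• x) ∧
  ξ •> dx = -(q • (dx <• ξ)) ∧
  ξ •> dξ = dξ <• ξ ∧
  ξ •> dη = q ^ 2 • (dη <• ξ) ∧
  η •> dx = -(q • (dx <• η)) + (1 - q ^ 2) • (dη <• x) ∧
  η •> dξ = q ^ 2 • (dξ <• η) + (1 - q ^ 2) • ((1 + q) • (dη <• ξ) - r • (dx <• x)) ∧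
  η •> dη = dη <• η

end

noncomputable section

open SuperAlgebra

set_option linter.unusedSimpArgs false

/-! A calculus that is free as a right module on dξ, dx, dη is the same thing as an algebra
homomorphism ρ from the coordinate algebra X to 3×3 matrices over X, encoding the left action,
together with a compatible differential. The substituted relations (13) prescribe ρ on the
coordinates, and ρ exists because the three matrices satisfy the defining relations of X
(`Point.leftMatrix`). The graded Leibniz rule says that u ↦ u + du is an algebra homomorphism into a
square-zero extension whose left action is twisted by the grading automorphism, so the differential
again exists by checking the five relations (`diffPoint`). Freeness then holds by construction.

Left covariance: every form is uniquely a sum of dX_i · u_i, so the coaction must send it to the sum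
of Δ(dX_i) δ(u_i). Right linearity is automatic. Left linearity amounts to the invariance of the
nine commutation relations under the quantum matrix T (`MinusRelations.act`). The condition Δ(du) =
(τ ⊗ d)δ(u) follows since both sides obey the same graded Leibniz rule and agree on coordinates
(`twistedDiff_coactHom`).

The Hopf structure and the coaction are constructed as well. Homomorphisms out of a presented
algebra are tuples satisfying its relations, called points. The comultiplication is the matrix
product of two points in a super tensor product, the counit is the identity matrix, and the antipode
comes from a point of the opposite algebra, with factors √-1 absorbing the super signs. These checks
rest on `OSP.Point.mul_table`, which reduces products of two entries of T to fixed normal forms, so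
that each identity becomes a comparison of coefficients. Everything is written in r, with q = r².

The two calculi differ because the coefficient of dx · η in x · dη is q⁻² - 1 for Γ₋ and 0 for Γ₊,
while η ≠ 0. -/

theorem mul_mul_eq_of_mul_eq {R : Type*} [Semigroup R] {x y p : R} (h : x * y = p) (z : R) :
    x * (y * z) = p * z := by
  rw [← mul_assoc, h]

/-! ### Points of the quantum supergroup and quadratic relations between matrix entries -/

namespace OSP

/-- Six elements of a complex algebra satisfying the defining relations of `O(SP_q(1|2))`, where
`q = r ^ 2`. -/
structure Point (r : ℂ) (R : Type*) [Ring R] [Algebra ℂ R] where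
  /-- the image of `a` -/
  a : R
  /-- the image of `b` -/
  b : R
  /-- the image of `c` -/
  c : R
  /-- the image of `d` -/
  d : R
  /-- the image of `α` -/
  α : R
  /-- the image of `δ` -/
  δ : R
  ab : a * b = (r ^ 2) ^ 2 • (b * a)
  ac : a * c = (r ^ 2) ^ 2 • (c * a)
  aα : a * α = r ^ 2 • (α * a)
  aδ : a * δ = r ^ 2 • (δ * a) + (r ^ 2 - (r ^ 2)⁻¹) • (α * c)
  ad : a * d = d * a
    + (r ^ 2 - (r ^ 2)⁻¹) • ((1 + (r ^ 2)⁻¹) • (b * c) + r⁻¹ • (α * δ))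
  bc : b * c = c * b
  bd : b * d = (r ^ 2) ^ 2 • (d * b)
  bα : b * α = (r ^ 2)⁻¹ • (α * b)
  bδ : b * δ = r ^ 2 • (δ * b)
  cd : c * d = (r ^ 2) ^ 2 • (d * c)
  cα : c * α = (r ^ 2)⁻¹ • (α * c)
  cδ : c * δ = r ^ 2 • (δ * c)
  dα : d * α = (r ^ 2)⁻¹ • (α * d) + ((r ^ 2)⁻¹ - r ^ 2) • (δ * b)
  dδ : d * δ = (r ^ 2)⁻¹ • (δ * d)
  αδ : α * δ = -(r ^ 2 • (δ * α)) + (r * (r ^ 2 - (r ^ 2)⁻¹)) • (b * c)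
  αα : α * α = (r * (r ^ 2 - 1)) • (b * a)
  δδ : δ * δ = (r * (r ^ 2 - 1)) • (d * c)
  superdet : a * d - r ^ 2 • (b * c) - r • (α * δ) = 1

namespace Point

variable {r : ℂ} {R : Type*} [Ring R] [Algebra ℂ R] (P : Point r R)

/-- The matrix entry `γ`. -/
def γ : R := r⁻¹ • (P.a * P.δ) - r ^ 3 • (P.c * P.α)

/-- The matrix entry `β`. -/
def β : R := r • (P.b * P.δ) - r⁻¹ • (P.α * P.d)

/-- The matrix entry `e`. -/
def e : R := 1 + r • (P.δ * P.α) + ((r ^ 2)⁻¹ - 1) • (P.b * P.c)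

theorem c_mul_b : P.c * P.b = P.b * P.c := P.bc.symm

theorem d_mul_b (hr : r ≠ 0) : P.d * P.b = (r ^ 4)⁻¹ • (P.b * P.d) := by
  rw [P.bd, smul_smul, ← pow_mul, inv_mul_cancel₀ (pow_ne_zero _ hr), one_smul]

theorem d_mul_c (hr : r ≠ 0) : P.d * P.c = (r ^ 4)⁻¹ • (P.c * P.d) := by
  rw [P.cd, smul_smul, ← pow_mul, inv_mul_cancel₀ (pow_ne_zero _ hr), one_smul]

/-- The superdeterminant relation, with α δ put into the order δ α, eliminates the word a d.
Combined with the commutator of a and d it also eliminates d a, so no normal word contains both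
letters. -/
theorem a_mul_d (hr : r ≠ 0) :
    P.a * P.d = 1 + (r ^ 4 + r ^ 2 - 1) • (P.b * P.c) - r ^ 3 • (P.δ * P.α) := by
  have h := P.superdet
  rw [P.αδ] at h
  linear_combination (norm := skip) h
  match_scalars <;> field_simp <;> ring

theorem d_mul_a (hr : r ≠ 0) :
    P.d * P.a = 1 + (r ^ 2)⁻¹ • (P.b * P.c) - r⁻¹ • (P.δ * P.α) := by
  have h := P.a_mul_d hr
  rw [P.ad, P.αδ] at h
  linear_combination (norm := skip) h
  match_scalars <;> field_simp <;> ring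

set_option maxHeartbeats 1000000 in
/-- Rewriting rules which bring every product of the generators into the normal order
`δ, α, b, c, a, d`. -/
theorem normal_order (hr : r ≠ 0) :
    P.a * P.b = r ^ 4 • (P.b * P.a) ∧ P.a * P.c = r ^ 4 • (P.c * P.a) ∧
    P.a * P.α = r ^ 2 • (P.α * P.a) ∧
    P.a * P.δ = (r ^ 2 - (r ^ 2)⁻¹) • (P.α * P.c) + r ^ 2 • (P.δ * P.a) ∧ P.c * P.b = P.b * P.c ∧
    P.d * P.b = (r ^ 4)⁻¹ • (P.b * P.d) ∧ P.d * P.c = (r ^ 4)⁻¹ • (P.c * P.d) ∧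
    P.b * P.α = (r ^ 2)⁻¹ • (P.α * P.b) ∧ P.b * P.δ = r ^ 2 • (P.δ * P.b) ∧
    P.c * P.α = (r ^ 2)⁻¹ • (P.α * P.c) ∧ P.c * P.δ = r ^ 2 • (P.δ * P.c) ∧
    P.d * P.α = (r ^ 2)⁻¹ • (P.α * P.d) + (-r ^ 2 + (r ^ 2)⁻¹) • (P.δ * P.b) ∧
    P.d * P.δ = (r ^ 2)⁻¹ • (P.δ * P.d) ∧
    P.α * P.δ = -r ^ 2 • (P.δ * P.α) + (r ^ 3 - r⁻¹) • (P.b * P.c) ∧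
    P.α * P.α = (r ^ 3 - r) • (P.b * P.a) ∧ P.δ * P.δ = (r⁻¹ - (r ^ 3)⁻¹) • (P.c * P.d) ∧
    P.a * P.d = 1 - r ^ 3 • (P.δ * P.α) + (r ^ 4 + r ^ 2 - 1) • (P.b * P.c) ∧
    P.d * P.a = 1 - r⁻¹ • (P.δ * P.α) + (r ^ 2)⁻¹ • (P.b * P.c) := by
  -- The relation for δ² ends in d c, which is itself out of order and has to be normalised first.
  have h2 := P.δδ
  rw [P.d_mul_c hr] at h2
  refine ⟨?_, ?_, ?_, ?_, ?_, ?_, ?_, ?_, ?_, ?_, ?_, ?_, ?_, ?_, ?_, ?_, ?_, ?_⟩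
  all_goals
    simp only [P.ab, P.ac, P.aα, P.aδ, P.c_mul_b, P.d_mul_b hr, P.d_mul_c hr, P.bα, P.bδ, P.cα,
      P.cδ, P.dα, P.dδ, P.αδ, P.αα, h2, P.a_mul_d hr, P.d_mul_a hr]
  all_goals match_scalars
  all_goals try field_simp
  all_goals try ring

set_option maxHeartbeats 4000000 in
/-- The multiplication table of the nine matrix entries. -/
theorem mul_table (hr : r ≠ 0) :
    P.a * P.γ = r ^ 2 • (P.γ * P.a) ∧
    P.a * P.d = (r ^ 2 + 1) • 1 - r ^ 2 • P.e + r ^ 4 • (P.b * P.c) ∧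
    P.α * P.a = (r ^ 2)⁻¹ • (P.a * P.α) ∧ P.α * P.α = (r⁻¹ - (r ^ 3)⁻¹) • (P.a * P.b) ∧
    P.α * P.γ = (r ^ 2)⁻¹ • P.a - (r ^ 2)⁻¹ • (P.a * P.e) ∧
    P.α * P.e = (r ^ 2)⁻¹ • P.α + (-r⁻¹ + (r ^ 3)⁻¹) • (P.a * P.β) ∧
    P.α * P.β = P.b - r ^ 2 • (P.b * P.e) ∧ P.α * P.c = -r⁻¹ • P.γ + (r ^ 2)⁻¹ • (P.a * P.δ) ∧
    P.α * P.δ = r • 1 - r • P.e + (r ^ 3 - r) • (P.b * P.c) ∧ P.b * P.a = (r ^ 4)⁻¹ • (P.a * P.b) ∧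
    P.b * P.α = (r ^ 2)⁻¹ • (P.α * P.b) ∧ P.b * P.γ = (r ^ 3)⁻¹ • P.α + (r ^ 4)⁻¹ • (P.a * P.β) ∧
    P.b * P.β = r ^ 2 • (P.β * P.b) ∧ P.b * P.δ = r⁻¹ • P.β + (r ^ 2)⁻¹ • (P.α * P.d) ∧
    P.b * P.d = r ^ 4 • (P.d * P.b) ∧ P.γ * P.α = -(r ^ 2)⁻¹ • P.a + (r ^ 2)⁻¹ • (P.a * P.e) ∧
    P.γ * P.b = r⁻¹ • P.α + (r ^ 2)⁻¹ • (P.a * P.β) ∧ P.γ * P.γ = (r⁻¹ - (r ^ 3)⁻¹) • (P.a * P.c) ∧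
    P.γ * P.e = (r ^ 2)⁻¹ • P.γ + (r⁻¹ - (r ^ 3)⁻¹) • (P.a * P.δ) ∧
    P.γ * P.β = r • 1 - r • P.e + (r ^ 3 - r) • (P.b * P.c) ∧
    P.γ * P.δ = (r ^ 4 - 1) • P.c - r ^ 4 • (P.δ * P.γ) ∧
    P.γ * P.d = r • P.δ + r ^ 2 • (P.c * P.β) ∧
    P.e * P.a = (1 - (r ^ 4)⁻¹) • P.a + (r ^ 4)⁻¹ • (P.a * P.e) ∧
    P.e * P.α = (1 + (r ^ 2)⁻¹ - (r ^ 4)⁻¹) • P.α + ((r ^ 3)⁻¹ - (r ^ 5)⁻¹) • (P.a * P.β) ∧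
    P.e * P.b = P.b * P.e ∧
    P.e * P.γ = (1 + (r ^ 2)⁻¹ - (r ^ 4)⁻¹) • P.γ + (-(r ^ 3)⁻¹ + (r ^ 5)⁻¹) • (P.a * P.δ) ∧
    P.e * P.e = -1 + (2 : ℂ) • P.e + (-r ^ 2 + 2 - (r ^ 2)⁻¹) • (P.b * P.c) ∧
    P.e * P.β = (r ^ 2)⁻¹ • P.β + (-r⁻¹ + (r ^ 3)⁻¹) • (P.α * P.d) ∧
    P.e * P.c = r ^ 2 • P.c - r ^ 2 • (P.δ * P.γ) ∧ P.e * P.δ = P.δ + (r - r⁻¹) • (P.c * P.β) ∧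
    P.β * P.a = (-r⁻¹ + (r ^ 5)⁻¹) • P.α + (r ^ 6)⁻¹ • (P.a * P.β) ∧
    P.β * P.α = -P.b + (r ^ 2)⁻¹ • (P.b * P.e) ∧
    P.β * P.γ = -r⁻¹ • 1 + r⁻¹ • P.e + (r⁻¹ - (r ^ 3)⁻¹) • (P.b * P.c) ∧
    P.β * P.e = (1 + (r ^ 2)⁻¹ - (r ^ 4)⁻¹) • P.β + ((r ^ 3)⁻¹ - (r ^ 5)⁻¹) • (P.α * P.d) ∧
    P.β * P.β = (r ^ 3 - r) • (P.d * P.b) ∧ P.β * P.c = (r ^ 2)⁻¹ • (P.c * P.β) ∧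
    P.β * P.δ = -(r ^ 2)⁻¹ • P.d + (r ^ 2)⁻¹ • (P.e * P.d) ∧ P.β * P.d = r ^ 2 • (P.d * P.β) ∧
    P.c * P.a = (r ^ 4)⁻¹ • (P.a * P.c) ∧ P.c * P.α = -(r ^ 3)⁻¹ • P.γ + (r ^ 4)⁻¹ • (P.a * P.δ) ∧
    P.c * P.b = P.b * P.c ∧ P.c * P.γ = (r ^ 2)⁻¹ • (P.γ * P.c) ∧
    P.c * P.e = r ^ 2 • P.c - r ^ 2 • (P.δ * P.γ) ∧ P.c * P.δ = r ^ 2 • (P.δ * P.c) ∧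
    P.δ * P.a = (r⁻¹ - (r ^ 5)⁻¹) • P.γ + (r ^ 6)⁻¹ • (P.a * P.δ) ∧
    P.δ * P.α = -r⁻¹ • 1 + r⁻¹ • P.e + (r⁻¹ - (r ^ 3)⁻¹) • (P.b * P.c) ∧
    P.δ * P.b = (r ^ 3)⁻¹ • P.β + (r ^ 4)⁻¹ • (P.α * P.d) ∧
    P.δ * P.e = P.δ + (-r⁻¹ + (r ^ 3)⁻¹) • (P.c * P.β) ∧
    P.δ * P.β = (r ^ 2)⁻¹ • P.d - (r ^ 2)⁻¹ • (P.e * P.d) ∧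
    P.δ * P.δ = (r⁻¹ - (r ^ 3)⁻¹) • (P.c * P.d) ∧ P.δ * P.d = r ^ 2 • (P.d * P.δ) ∧
    P.d * P.a = (1 + (r ^ 2)⁻¹) • 1 - (r ^ 2)⁻¹ • P.e + (r ^ 4)⁻¹ • (P.b * P.c) ∧
    P.d * P.α = (-r⁻¹ + (r ^ 5)⁻¹) • P.β + (r ^ 6)⁻¹ • (P.α * P.d) ∧
    P.d * P.γ = r⁻¹ • P.δ + (r ^ 4)⁻¹ • (P.c * P.β) ∧
    P.d * P.e = (1 - (r ^ 4)⁻¹) • P.d + (r ^ 4)⁻¹ • (P.e * P.d) ∧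
    P.d * P.c = (r ^ 4)⁻¹ • (P.c * P.d) := by
  obtain ⟨h1, h2, h3, h4, h5, h6, h7, h8, h9, h10, h11, h12, h13, h14, h15, h16, h17, h18⟩ :=
    P.normal_order hr
  refine ⟨?_, ?_, ?_, ?_, ?_, ?_, ?_, ?_, ?_, ?_, ?_, ?_, ?_, ?_, ?_, ?_, ?_, ?_, ?_, ?_, ?_, ?_, ?_,
    ?_, ?_, ?_, ?_, ?_, ?_, ?_, ?_, ?_, ?_, ?_, ?_, ?_, ?_, ?_, ?_, ?_, ?_, ?_, ?_, ?_, ?_, ?_,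
    ?_, ?_, ?_, ?_, ?_, ?_, ?_, ?_, ?_, ?_⟩
  -- Both sides are expanded in the six generators and normalised; the versions through
  -- `mul_mul_eq_of_mul_eq` apply the rules inside right-associated words. The right sides of the
  -- table use only words that are left sides of no entry, so the table can itself serve as a set of
  -- rewriting rules, of degree at most two in the nine entries.
  all_goals
    simp only [γ, β, e, mul_assoc, mul_add, add_mul, mul_sub, sub_mul, smul_mul_assoc,
      mul_smul_comm, one_mul, mul_one, neg_mul, mul_neg, h1, h2, h3, h4, h5, h6, h7, h8, h9, h10,
      h11, h12, h13, h14, h15, h16, h17, h18, mul_mul_eq_of_mul_eq h1, mul_mul_eq_of_mul_eq h2, mul_mul_eq_of_mul_eq h3, mul_mul_eq_of_mul_eq h4, mul_mul_eq_of_mul_eq h5, mul_mul_eq_of_mul_eq h6, mul_mul_eq_of_mul_eq h7, mul_mul_eq_of_mul_eq h8, mul_mul_eq_of_mul_eq h9, mul_mul_eq_of_mul_eq h10, mul_mul_eq_of_mul_eq h11, mul_mul_eq_of_mul_eq h12, mul_mul_eq_of_mul_eq h13, mul_mul_eq_of_mul_eq h14, mul_mul_eq_of_mul_eq h15, mul_mul_eq_of_mul_eq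 h16, mul_mul_eq_of_mul_eq h17, mul_mul_eq_of_mul_eq h18]
  all_goals match_scalars
  all_goals try field_simp
  all_goals try ring

end Point
end OSP

/-! ### Homomorphisms on super tensor products -/

section SuperTensorTheory

variable {A B C X : Type*} [Ring A] [Algebra ℂ A] [SuperAlgebra A] [Ring B] [Algebra ℂ B]
  [SuperAlgebra B] [Ring C] [Algebra ℂ C] [SuperAlgebra C] [Ring X] [Algebra ℂ X] [SuperAlgebra X]

/-- Pure tensors in the super tensor product. -/
def superTmul (a : A) (b : B) : SuperTensor A B := superOf A B (a ⊗ₜ b)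

infixl:100 " ⊗ˢ " => superTmul

theorem superOf_tmul (a : A) (b : B) : superOf A B (a ⊗ₜ b) = a ⊗ˢ b := rfl

theorem superOf_symm_superTmul (a : A) (b : B) : (superOf A B).symm (a ⊗ˢ b) = a ⊗ₜ b := rfl

theorem add_superTmul (a a' : A) (b : B) : (a + a') ⊗ˢ b = a ⊗ˢ b + a' ⊗ˢ b := by
  simp only [superTmul, TensorProduct.add_tmul, map_add]

theorem superTmul_add (a : A) (b b' : B) : a ⊗ˢ (b + b') = a ⊗ˢ b + a ⊗ˢ b' := by
  simp only [superTmul, TensorProduct.tmul_add, map_add]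

theorem sub_superTmul (a a' : A) (b : B) : (a - a') ⊗ˢ b = a ⊗ˢ b - a' ⊗ˢ b := by
  simp only [superTmul, TensorProduct.sub_tmul, map_sub]

theorem superTmul_sub (a : A) (b b' : B) : a ⊗ˢ (b - b') = a ⊗ˢ b - a ⊗ˢ b' := by
  simp only [superTmul, TensorProduct.tmul_sub, map_sub]

theorem neg_superTmul (a : A) (b : B) : (-a) ⊗ˢ b = -(a ⊗ˢ b) := by
  simp only [superTmul, TensorProduct.neg_tmul, map_neg]

theorem superTmul_neg (a : A) (b : B) : a ⊗ˢ (-b) = -(a ⊗ˢ b) := by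
  simp only [superTmul, TensorProduct.tmul_neg, map_neg]

theorem smul_superTmul (c : ℂ) (a : A) (b : B) : (c • a) ⊗ˢ b = c • (a ⊗ˢ b) := by
  simp only [superTmul, ← TensorProduct.smul_tmul', map_smul]

theorem superTmul_smul (c : ℂ) (a : A) (b : B) : a ⊗ˢ (c • b) = c • (a ⊗ˢ b) := by
  simp only [superTmul, TensorProduct.tmul_smul, map_smul]

theorem zero_superTmul (b : B) : (0 : A) ⊗ˢ b = 0 := by
  simp only [superTmul, TensorProduct.zero_tmul, map_zero]

theorem superTmul_zero (a : A) : a ⊗ˢ (0 : B) = 0 := by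
  simp only [superTmul, TensorProduct.tmul_zero, map_zero]

theorem one_superTmul_one : (1 : A) ⊗ˢ (1 : B) = 1 := rfl

theorem evenPart_add_oddPart (a : A) : (evenPart A a : A) + (oddPart A a : A) = a := by
  change (2⁻¹ : ℂ) • (a + parity a) + (2⁻¹ : ℂ) • (a - parity a) = a
  rw [← smul_add, add_add_sub_cancel, ← two_smul ℂ a, smul_smul]
  norm_num

theorem parity_evenPart (a : A) : parity (evenPart A a : A) = evenPart A a :=
  mem_homog_zero.1 (evenPart A a).2

theorem parity_oddPart (a : A) : parity (oddPart A a : A) = -oddPart A a :=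
  mem_homog_one.1 (oddPart A a).2

/-- An even b contributes no sign, so a' may be inhomogeneous: split it into its even and odd parts.
In the odd companion below, the sign depends on a' alone and is absorbed by applying `parity` to it.
-/
theorem superTmul_mul_even (a a' : A) {b : B} (hb : parity b = b) (b' : B) :
    a ⊗ˢ b * a' ⊗ˢ b' = (a * a') ⊗ˢ (b * b') := by
  have key : ∀ {i : ZMod 2} (a' : homog A i), a ⊗ˢ b * (a' : A) ⊗ˢ b' = (a * a') ⊗ˢ (b * b') :=
    fun a' => GradedTensorProduct.tmul_zero_coe_mul_coe_tmul (homog A) (homog B) a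
      ⟨b, mem_homog_zero.2 hb⟩ a' b'
  rw [← evenPart_add_oddPart a', mul_add, add_superTmul, add_superTmul, mul_add, key, key]

theorem superTmul_mul_odd (a a' : A) {b : B} (hb : parity b = -b) (b' : B) :
    a ⊗ˢ b * a' ⊗ˢ b' = (a * parity a') ⊗ˢ (b * b') := by
  have h0 : a ⊗ˢ b * (evenPart A a' : A) ⊗ˢ b' = (a * evenPart A a') ⊗ˢ (b * b') :=
    GradedTensorProduct.tmul_coe_mul_zero_coe_tmul (homog A) (homog B) a
      ⟨b, mem_homog_one.2 hb⟩ (evenPart A a') b'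
  have h1 : a ⊗ˢ b * (oddPart A a' : A) ⊗ˢ b' = -((a * oddPart A a') ⊗ˢ (b * b')) := by
    refine (GradedTensorProduct.tmul_coe_mul_coe_tmul (homog A) (homog B) a
      ⟨b, mem_homog_one.2 hb⟩ (oddPart A a') b').trans ?_
    rw [mul_one, uzpow_one, Units.neg_smul, one_smul]
    rfl
  rw [← evenPart_add_oddPart a', map_add, parity_evenPart, parity_oddPart, mul_add,
    add_superTmul, add_superTmul, mul_add, h0, h1, mul_neg, neg_superTmul]

/-- Splitting the second factor suffices, because the sign rule for products only needs that factor
to be homogeneous. No zero case is required, since zero is a pure tensor with even second factor. -/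
theorem superTensor_induction {p : SuperTensor A B → Prop} (z : SuperTensor A B)
    (even : ∀ (a : A) (b : B), parity b = b → p (a ⊗ˢ b))
    (odd : ∀ (a : A) (b : B), parity b = -b → p (a ⊗ˢ b))
    (add : ∀ z w, p z → p w → p (z + w)) : p z := by
  have h : ∀ z : A ⊗[ℂ] B, p (superOf A B z) := by
    intro z
    induction z using TensorProduct.induction_on with
    | zero => simpa only [zero_superTmul, map_zero] using even 0 0 (map_zero _)
    | tmul a b =>
      rw [superOf_tmul, ← evenPart_add_oddPart b, superTmul_add]
      exact add _ _ (even _ _ (parity_evenPart b)) (odd _ _ (parity_oddPart b))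
    | add z w hz hw => rw [map_add]; exact add _ _ hz hw
  exact h ((superOf A B).symm z)

theorem superTensor_induction' {p : SuperTensor A B → Prop} (z : SuperTensor A B)
    (tmul : ∀ (a : A) (b : B), p (a ⊗ˢ b)) (add : ∀ z w, p z → p w → p (z + w)) : p z :=
  superTensor_induction z (fun a b _ => tmul a b) (fun a b _ => tmul a b) add

/-- A linear map on a super tensor product which is multiplicative on pure tensors with a
homogeneous second factor is an algebra homomorphism. -/
def superAlgHom (f : SuperTensor A B →ₗ[ℂ] C) (one : f (1 ⊗ˢ 1) = 1)
    (even : ∀ (a a' : A) (b b' : B), parity b = b →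
      f ((a * a') ⊗ˢ (b * b')) = f (a ⊗ˢ b) * f (a' ⊗ˢ b'))
    (odd : ∀ (a a' : A) (b b' : B), parity b = -b →
      f ((a * parity a') ⊗ˢ (b * b')) = f (a ⊗ˢ b) * f (a' ⊗ˢ b')) :
    SuperTensor A B →ₐ[ℂ] C :=
  AlgHom.ofLinearMap f one (by
    intro z w
    induction w using superTensor_induction' with
    | add w w' hw hw' => rw [mul_add, map_add, map_add, mul_add, hw, hw']
    | tmul a' b' =>
      induction z using superTensor_induction with
      | add z z' hz hz' => rw [add_mul, map_add, map_add, add_mul, hz, hz']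
      | even a b hb => rw [superTmul_mul_even _ _ hb, even _ _ _ _ hb]
      | odd a b hb => rw [superTmul_mul_odd _ _ hb, odd _ _ _ _ hb])

/-- The super tensor product of two parity-preserving algebra homomorphisms. -/
def superMap {A' B' : Type*} [Ring A'] [Algebra ℂ A'] [SuperAlgebra A'] [Ring B'] [Algebra ℂ B']
    [SuperAlgebra B'] (f : A →ₐ[ℂ] A') (g : B →ₐ[ℂ] B') (hf : ∀ a, f (parity a) = parity (f a))
    (hg : ∀ b, g (parity b) = parity (g b)) : SuperTensor A B →ₐ[ℂ] SuperTensor A' B' :=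
  have h : ∀ a b, ((superOf A' B').toLinearMap ∘ₗ TensorProduct.map f.toLinearMap g.toLinearMap ∘ₗ
      (superOf A B).symm.toLinearMap) (a ⊗ˢ b) = f a ⊗ˢ g b := fun _ _ => rfl
  superAlgHom ((superOf A' B').toLinearMap ∘ₗ TensorProduct.map f.toLinearMap g.toLinearMap ∘ₗ
      (superOf A B).symm.toLinearMap)
    (by rw [h, map_one, map_one, one_superTmul_one])
    (by
      intro a a' b b' hb
      rw [h, h, h, superTmul_mul_even _ _ (by rw [← hg, hb]), map_mul, map_mul])
    (by
      intro a a' b b' hb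
      rw [h, h, h, superTmul_mul_odd _ _ (by rw [← hg, hb, map_neg]), map_mul, map_mul, hf])

theorem superMap_tmul {A' B' : Type*} [Ring A'] [Algebra ℂ A'] [SuperAlgebra A'] [Ring B']
    [Algebra ℂ B'] [SuperAlgebra B'] (f : A →ₐ[ℂ] A') (g : B →ₐ[ℂ] B')
    (hf : ∀ a, f (parity a) = parity (f a)) (hg : ∀ b, g (parity b) = parity (g b)) (a : A) (b : B) :
    superMap f g hf hg (a ⊗ˢ b) = f a ⊗ˢ g b := rfl

theorem algHom_id_parity (a : A) : AlgHom.id ℂ A (parity a) = parity (AlgHom.id ℂ A a) := rfl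

/-- The super tensor product of two superalgebras is a superalgebra. -/
instance : SuperAlgebra (SuperTensor A B) where
  parity := superMap parity parity (fun _ => rfl) (fun _ => rfl)
  parity_parity := by
    intro z
    induction z using superTensor_induction' with
    | tmul a b => rw [superMap_tmul, superMap_tmul, parity_parity, parity_parity]
    | add z w hz hw => rw [map_add, map_add, hz, hw]

theorem parity_superTmul (a : A) (b : B) : parity (a ⊗ˢ b) = parity a ⊗ˢ parity b := rfl

/-- The associativity of the super tensor product, as an algebra homomorphism. -/
def superAssoc : SuperTensor (SuperTensor A B) C →ₐ[ℂ] SuperTensor A (SuperTensor B C) :=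
  let f : SuperTensor (SuperTensor A B) C →ₗ[ℂ] SuperTensor A (SuperTensor B C) :=
    (superOf A (SuperTensor B C)).toLinearMap ∘ₗ
      TensorProduct.map LinearMap.id (superOf B C).toLinearMap ∘ₗ
      (TensorProduct.assoc ℂ A B C).toLinearMap ∘ₗ
      TensorProduct.map (superOf A B).symm.toLinearMap LinearMap.id ∘ₗ
      (superOf (SuperTensor A B) C).symm.toLinearMap
  have h : ∀ a b c, f ((a ⊗ˢ b) ⊗ˢ c) = a ⊗ˢ (b ⊗ˢ c) := fun _ _ _ => rfl
  superAlgHom f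
    (by rw [← one_superTmul_one (A := A) (B := B), h]; rfl)
    (by
      -- Four cases arise from the parities of b and c in (a ⊗ b) ⊗ c. On the left, c passes a' ⊗ b'
      -- and b passes a'; on the right, b ⊗ c, of parity p(b) + p(c), passes a' and then c passes
      -- b'. The total signs agree.
      intro z z' c c' hc
      induction z using superTensor_induction with
      | add z w hz hw => rw [add_mul, add_superTmul, add_superTmul, map_add, map_add, hz, hw, add_mul]
      | even a b hb =>
        induction z' using superTensor_induction' with
        | add z w hz hw =>
          rw [mul_add, add_superTmul, add_superTmul, map_add, map_add, hz, hw, mul_add]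
        | tmul a' b' =>
          rw [superTmul_mul_even _ _ hb, h, h, h, superTmul_mul_even, superTmul_mul_even _ _ hc]
          rw [parity_superTmul, hb, hc]
      | odd a b hb =>
        induction z' using superTensor_induction' with
        | add z w hz hw =>
          rw [mul_add, add_superTmul, add_superTmul, map_add, map_add, hz, hw, mul_add]
        | tmul a' b' =>
          rw [superTmul_mul_odd _ _ hb, h, h, h, superTmul_mul_odd, superTmul_mul_even _ _ hc]
          rw [parity_superTmul, hb, hc, neg_superTmul])
    (by
      intro z z' c c' hc
      induction z using superTensor_induction with
      | add z w hz hw => rw [add_mul, add_superTmul, add_superTmul, map_add, map_add, hz, hw, add_mul]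
      | even a b hb =>
        induction z' using superTensor_induction' with
        | add z w hz hw =>
          rw [map_add, mul_add, add_superTmul, add_superTmul, map_add, map_add, hz, hw, mul_add]
        | tmul a' b' =>
          rw [parity_superTmul, superTmul_mul_even _ _ hb, h, h, h, superTmul_mul_odd,
            superTmul_mul_odd _ _ hc]
          rw [parity_superTmul, hb, hc, superTmul_neg]
      | odd a b hb =>
        induction z' using superTensor_induction' with
        | add z w hz hw =>
          rw [map_add, mul_add, add_superTmul, add_superTmul, map_add, map_add, hz, hw, mul_add]
        | tmul a' b' =>
          rw [parity_superTmul, superTmul_mul_odd _ _ hb, h, h, h, superTmul_mul_even,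
            superTmul_mul_odd _ _ hc, parity_parity]
          rw [parity_superTmul, hb, hc, neg_superTmul, superTmul_neg, neg_neg])

theorem superAssoc_tmul (a : A) (b : B) (c : C) :
    superAssoc ((a ⊗ˢ b) ⊗ˢ c) = a ⊗ˢ (b ⊗ˢ c) := rfl

/-- `ε ⊗ id`, as an algebra homomorphism, for an even character `ε`. -/
def superLid (ε : A →ₐ[ℂ] ℂ) (hε : ∀ a, ε (parity a) = ε a) : SuperTensor A X →ₐ[ℂ] X :=
  let f : SuperTensor A X →ₗ[ℂ] X := (TensorProduct.lid ℂ X).toLinearMap ∘ₗ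
    TensorProduct.map ε.toLinearMap LinearMap.id ∘ₗ (superOf A X).symm.toLinearMap
  have h : ∀ a x, f (a ⊗ˢ x) = ε a • x := fun _ _ => rfl
  superAlgHom f
    (by rw [h, map_one, one_smul])
    (by intro a a' x x' _; rw [h, h, h, map_mul, smul_mul_smul_comm])
    (by intro a a' x x' _; rw [h, h, h, map_mul, hε, smul_mul_smul_comm])

theorem superLid_tmul (ε : A →ₐ[ℂ] ℂ) (hε : ∀ a, ε (parity a) = ε a) (a : A) (x : X) :
    superLid ε hε (a ⊗ˢ x) = ε a • x := rfl

/-- `id ⊗ ε`, as an algebra homomorphism, for an even character `ε`. -/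
def superRid (ε : A →ₐ[ℂ] ℂ) (hε : ∀ a, ε (parity a) = ε a) : SuperTensor X A →ₐ[ℂ] X :=
  let f : SuperTensor X A →ₗ[ℂ] X := (TensorProduct.rid ℂ X).toLinearMap ∘ₗ
    TensorProduct.map LinearMap.id ε.toLinearMap ∘ₗ (superOf X A).symm.toLinearMap
  have h : ∀ x a, f (x ⊗ˢ a) = ε a • x := fun _ _ => rfl
  superAlgHom f
    (by rw [h, map_one, one_smul])
    (by intro x x' a a' _; rw [h, h, h, map_mul, smul_mul_smul_comm])
    (by
      intro x x' a a' ha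
      -- An even character kills odd elements, so both sides of the sign-twisted case vanish.
      have h0 : ε a = 0 := by
        have := hε a
        rw [ha, map_neg] at this
        exact self_eq_neg.1 this.symm
      rw [h, h, h, map_mul, h0, zero_mul, zero_smul, zero_smul, zero_mul])

theorem superRid_tmul (ε : A →ₐ[ℂ] ℂ) (hε : ∀ a, ε (parity a) = ε a) (a : A) (x : X) :
    superRid ε hε (x ⊗ˢ a) = ε a • x := rfl

/-- The space underlying a triple super tensor product. -/
def superTripleSymm : SuperTensor A (SuperTensor B C) →ₗ[ℂ] A ⊗[ℂ] (B ⊗[ℂ] C) :=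
  TensorProduct.map LinearMap.id (superOf B C).symm.toLinearMap ∘ₗ
    (superOf A (SuperTensor B C)).symm.toLinearMap

/-- Coassociativity of a coaction can be checked on generators. -/
theorem coassoc_of_adjoin_eq_top {Δ : A →ₐ[ℂ] SuperTensor A A} {δ : X →ₐ[ℂ] SuperTensor A X}
    (hΔ : ∀ a, Δ (parity a) = parity (Δ a)) (hδ : ∀ u, δ (parity u) = parity (δ u))
    {s : Set X} (hs : Algebra.adjoin ℂ s = ⊤)
    (h : ∀ u ∈ s, superMap (AlgHom.id ℂ A) δ algHom_id_parity hδ (δ u) =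
      superAssoc (superMap Δ (AlgHom.id ℂ X) hΔ algHom_id_parity (δ u))) (u : X) :
    TensorProduct.map LinearMap.id ((superOf A X).symm.toLinearMap ∘ₗ δ.toLinearMap)
        ((superOf A X).symm (δ u)) =
      TensorProduct.assoc ℂ A A X
        (TensorProduct.map ((superOf A A).symm.toLinearMap ∘ₗ Δ.toLinearMap) LinearMap.id
          ((superOf A X).symm (δ u))) := by
  -- Both composites are algebra homomorphisms into the triple super tensor product, so generators
  -- decide. The two identities that follow forget the products and recover the plain tensor
  -- formulation.
  have key : (superMap (AlgHom.id ℂ A) δ algHom_id_parity hδ).comp δ =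
      (superAssoc.comp (superMap Δ (AlgHom.id ℂ X) hΔ algHom_id_parity)).comp δ :=
    AlgHom.ext_of_adjoin_eq_top hs h
  have h1 : ∀ z : SuperTensor A X,
      superTripleSymm (superMap (AlgHom.id ℂ A) δ algHom_id_parity hδ z) =
      TensorProduct.map LinearMap.id ((superOf A X).symm.toLinearMap ∘ₗ δ.toLinearMap)
        ((superOf A X).symm z) := by
    intro z
    induction z using superTensor_induction' with
    | tmul a b => rfl
    | add z w hz hw => simp only [map_add, hz, hw]
  have h2 : ∀ z : SuperTensor A X,
      superTripleSymm (superAssoc (superMap Δ (AlgHom.id ℂ X) hΔ algHom_id_parity z)) =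
      TensorProduct.assoc ℂ A A X
        (TensorProduct.map ((superOf A A).symm.toLinearMap ∘ₗ Δ.toLinearMap) LinearMap.id
          ((superOf A X).symm z)) := by
    intro z
    induction z using superTensor_induction' with
    | tmul a b =>
      change superTripleSymm (superAssoc (Δ a ⊗ˢ b)) =
        TensorProduct.assoc ℂ A A X ((superOf A A).symm (Δ a) ⊗ₜ b)
      induction Δ a using superTensor_induction' with
      | tmul a' a'' => rfl
      | add z w hz hw => simp only [add_superTmul, TensorProduct.add_tmul, map_add, hz, hw]
    | add z w hz hw => simp only [map_add, hz, hw]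
  rw [← h1, ← h2]
  exact congrArg superTripleSymm (DFunLike.congr_fun key u)

/-- Both sides are algebra homomorphisms in u, as the grading of a super tensor product is an
algebra automorphism. -/
theorem coact_parity_of_adjoin_eq_top {δ : X →ₐ[ℂ] SuperTensor A X} {s : Set X}
    (hs : Algebra.adjoin ℂ s = ⊤) (h : ∀ u ∈ s, δ (parity u) = parity (δ u)) (u : X) :
    δ (parity u) = parity (δ u) :=
  DFunLike.congr_fun
    (AlgHom.ext_of_adjoin_eq_top (φ₁ := δ.comp parity) (φ₂ := parity.comp δ) hs h) u

end SuperTensorTheory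

/-! ### Super-antihomomorphisms from ordinary antihomomorphisms -/

section AntiHom

variable {A : Type*} [Ring A] [Algebra ℂ A] [SuperAlgebra A]

/-- The super-antihomomorphism `a ↦ T a` (`a` even), `a ↦ -√-1 T a` (`a` odd) obtained from an
antihomomorphism `T`. -/
def superAntiHom (T : A →ₐ[ℂ] Aᵐᵒᵖ) : A →ₗ[ℂ] A :=
  (MulOpposite.opLinearEquiv ℂ).symm.toLinearMap ∘ₗ T.toLinearMap ∘ₗ
    -- The weights have sum 1 and difference -√-1, the required factors on even and on odd elements.
    (((1 - Complex.I) / 2) • LinearMap.id + ((1 + Complex.I) / 2) • parity.toLinearMap)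

variable (T : A →ₐ[ℂ] Aᵐᵒᵖ)

theorem superAntiHom_apply (a : A) :
    superAntiHom T a = ((1 - Complex.I) / 2) • (T a).unop +
      ((1 + Complex.I) / 2) • (T (parity a)).unop := by
  simp [superAntiHom]

theorem superAntiHom_even {a : A} (ha : parity a = a) : superAntiHom T a = (T a).unop := by
  rw [superAntiHom_apply, ha, ← add_smul, ← add_div, sub_add_add_cancel]
  norm_num

theorem superAntiHom_odd {a : A} (ha : parity a = -a) :
    superAntiHom T a = -(Complex.I • (T a).unop) := by
  rw [superAntiHom_apply, ha, map_neg, MulOpposite.unop_neg]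
  module

theorem superAntiHom_even_mul {a : A} (ha : parity a = a) (b : A) :
    superAntiHom T (a * b) = superAntiHom T b * superAntiHom T a := by
  rw [superAntiHom_even T ha, superAntiHom_apply, superAntiHom_apply, map_mul, map_mul, ha, map_mul,
    MulOpposite.unop_mul, MulOpposite.unop_mul, add_mul, smul_mul_assoc, smul_mul_assoc]

/-- For two odd factors, (-√-1)² = -1 produces the super sign. Writing that sign as `parity b` keeps
the formula valid for inhomogeneous b. -/
theorem superAntiHom_odd_mul {a : A} (ha : parity a = -a) (b : A) :
    superAntiHom T (a * b) = superAntiHom T (parity b) * superAntiHom T a := by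
  rw [superAntiHom_odd T ha, superAntiHom_apply, superAntiHom_apply, map_mul, map_mul, ha, map_mul,
    map_neg, parity_parity, MulOpposite.unop_mul, MulOpposite.unop_mul, MulOpposite.unop_neg]
  simp only [mul_neg, add_mul, smul_mul_assoc, mul_smul_comm]
  match_scalars
  · linear_combination (1 / 2 : ℂ) * Complex.I_sq
  · linear_combination (-1 / 2 : ℂ) * Complex.I_sq

theorem superAntiHom_parity (hT : ∀ a, (T (parity a)).unop = parity (T a).unop) (a : A) :
    superAntiHom T (parity a) = parity (superAntiHom T a) := by
  rw [superAntiHom_apply, superAntiHom_apply, map_add, map_smul, map_smul, ← hT, ← hT]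

end AntiHom

/-! ### Checking the antipode axioms on generators -/

section Antipode

variable {A : Type*} [Ring A] [Algebra ℂ A] [SuperAlgebra A]

theorem superTensor_induction_homog {B : Type*} [Ring B] [Algebra ℂ B] [SuperAlgebra B]
    {p : SuperTensor A B → Prop} (z : SuperTensor A B)
    (ee : ∀ (a : A) (b : B), parity a = a → parity b = b → p (a ⊗ˢ b))
    (eo : ∀ (a : A) (b : B), parity a = a → parity b = -b → p (a ⊗ˢ b))
    (oe : ∀ (a : A) (b : B), parity a = -a → parity b = b → p (a ⊗ˢ b))
    (oo : ∀ (a : A) (b : B), parity a = -a → parity b = -b → p (a ⊗ˢ b))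
    (add : ∀ z w, p z → p w → p (z + w)) : p z := by
  induction z using superTensor_induction with
  | add z w hz hw => exact add z w hz hw
  | even a b hb =>
    rw [← evenPart_add_oddPart a, add_superTmul]
    exact add _ _ (ee _ _ (parity_evenPart a) hb) (oe _ _ (parity_oddPart a) hb)
  | odd a b hb =>
    rw [← evenPart_add_oddPart a, add_superTmul]
    exact add _ _ (eo _ _ (parity_evenPart a) hb) (oo _ _ (parity_oddPart a) hb)

/-- The map `a ⊗ b ↦ S(a) b`. -/
def antipodeMulLeft (S : A →ₗ[ℂ] A) : SuperTensor A A →ₗ[ℂ] A :=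
  LinearMap.mul' ℂ A ∘ₗ TensorProduct.map S LinearMap.id ∘ₗ (superOf A A).symm.toLinearMap

/-- The map `a ⊗ b ↦ a S(b)`. -/
def antipodeMulRight (S : A →ₗ[ℂ] A) : SuperTensor A A →ₗ[ℂ] A :=
  LinearMap.mul' ℂ A ∘ₗ TensorProduct.map LinearMap.id S ∘ₗ (superOf A A).symm.toLinearMap

theorem antipodeMulLeft_tmul (S : A →ₗ[ℂ] A) (a b : A) :
    antipodeMulLeft S (a ⊗ˢ b) = S a * b := rfl

theorem antipodeMulRight_tmul (S : A →ₗ[ℂ] A) (a b : A) :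
    antipodeMulRight S (a ⊗ˢ b) = a * S b := rfl

variable {S : A →ₗ[ℂ] A}

/-- This is the multiplicative step for the axiom m(S ⊗ id)Δ = ε: in S(b) S(a) a' b' the inner
factor sums to a scalar and can be pulled out. Since the axiom is not linear over products, it is
this closure property that allows passing from generators to the whole algebra. -/
theorem antipodeMulLeft_mul (hS : ∀ a, S (parity a) = parity (S a))
    (even_mul : ∀ a b, parity a = a → S (a * b) = S b * S a)
    (odd_mul : ∀ a b, parity a = -a → S (a * b) = S (parity b) * S a)
    {z : SuperTensor A A} {k : ℂ} (hz : antipodeMulLeft S z = algebraMap ℂ A k)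
    (w : SuperTensor A A) : antipodeMulLeft S (z * w) = k • antipodeMulLeft S w := by
  induction w using superTensor_induction' with
  | add w w' hw hw' => rw [mul_add, map_add, map_add, hw, hw', smul_add]
  | tmul b b' =>
    -- The signs from the tensor product and from S combine to (-1) to the power p(b)(p(a) + p(a')).
    -- They therefore depend only on the parity of S(a) a': its even part meets S(b), its odd part
    -- meets S(τ(b)). Doubling avoids halves, and a scalar has no odd part.
    have key : (2 : ℂ) • antipodeMulLeft S (z * b ⊗ˢ b') =
        S b * (antipodeMulLeft S z + parity (antipodeMulLeft S z)) * b' +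
        S (parity b) * (antipodeMulLeft S z - parity (antipodeMulLeft S z)) * b' := by
      clear hz
      induction z using superTensor_induction_homog with
      | ee a a' ha ha' =>
        rw [superTmul_mul_even _ _ ha', antipodeMulLeft_tmul, antipodeMulLeft_tmul,
          even_mul _ _ ha, map_mul, ← hS, ha, ha', sub_self, ← two_smul ℂ (S a * a')]
        simp only [mul_zero, zero_mul, add_zero, mul_smul_comm, smul_mul_assoc, mul_assoc]
      | eo a a' ha ha' =>
        rw [superTmul_mul_odd _ _ ha', antipodeMulLeft_tmul, antipodeMulLeft_tmul,
          even_mul _ _ ha, map_mul, ← hS, ha, ha', mul_neg, add_neg_cancel, sub_neg_eq_add,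
          ← two_smul ℂ (S a * a')]
        simp only [mul_zero, zero_mul, zero_add, mul_smul_comm, smul_mul_assoc, mul_assoc]
      | oe a a' ha ha' =>
        rw [superTmul_mul_even _ _ ha', antipodeMulLeft_tmul, antipodeMulLeft_tmul,
          odd_mul _ _ ha, map_mul, ← hS, ha, ha', map_neg, neg_mul, add_neg_cancel, sub_neg_eq_add,
          ← two_smul ℂ (S a * a')]
        simp only [mul_zero, zero_mul, zero_add, mul_smul_comm, smul_mul_assoc, mul_assoc]
      | oo a a' ha ha' =>
        rw [superTmul_mul_odd _ _ ha', antipodeMulLeft_tmul, antipodeMulLeft_tmul,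
          odd_mul _ _ ha, map_mul, ← hS, ha, ha', map_neg, parity_parity, neg_mul_neg, sub_self,
          ← two_smul ℂ (S a * a')]
        simp only [mul_zero, zero_mul, add_zero, mul_smul_comm, smul_mul_assoc, mul_assoc]
      | add z z' hz hz' =>
        simp only [add_mul, map_add, smul_add, hz, hz', mul_add, mul_sub, sub_mul]
        abel
    rw [hz, AlgHom.commutes, sub_self, mul_zero, zero_mul, add_zero, ← two_smul ℂ (algebraMap ℂ A k),
      Algebra.algebraMap_eq_smul_one, mul_smul_comm, mul_smul_comm, smul_mul_assoc,
      smul_mul_assoc, mul_one] at key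
    rw [antipodeMulLeft_tmul]
    exact smul_right_injective A (two_ne_zero (α := ℂ)) key

/-- Here the scalar sits in the middle of a (b S(b')) S(a'). An odd a' applies the grading
automorphism to the inner factor, which is harmless for a scalar. -/
theorem antipodeMulRight_mul (hS : ∀ a, S (parity a) = parity (S a))
    (even_mul : ∀ a b, parity a = a → S (a * b) = S b * S a)
    (odd_mul : ∀ a b, parity a = -a → S (a * b) = S (parity b) * S a)
    (z : SuperTensor A A) {w : SuperTensor A A} {k : ℂ}
    (hw : antipodeMulRight S w = algebraMap ℂ A k) :
    antipodeMulRight S (z * w) = k • antipodeMulRight S z := by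
  induction z using superTensor_induction with
  | add z z' hz hz' => rw [add_mul, map_add, map_add, hz, hz', smul_add]
  | even a a' ha =>
    have key : antipodeMulRight S (a ⊗ˢ a' * w) = a * antipodeMulRight S w * S a' := by
      clear hw
      induction w using superTensor_induction' with
      | add w w' hw hw' => rw [mul_add, map_add, map_add, mul_add, add_mul, hw, hw']
      | tmul b b' =>
        rw [superTmul_mul_even _ _ ha, antipodeMulRight_tmul, antipodeMulRight_tmul, even_mul _ _ ha]
        simp only [mul_assoc]
    rw [key, hw, Algebra.algebraMap_eq_smul_one, mul_smul_comm, smul_mul_assoc, mul_one,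
      antipodeMulRight_tmul]
  | odd a a' ha =>
    have key : antipodeMulRight S (a ⊗ˢ a' * w) = a * parity (antipodeMulRight S w) * S a' := by
      clear hw
      induction w using superTensor_induction' with
      | add w w' hw hw' => rw [mul_add, map_add, map_add, map_add, mul_add, add_mul, hw, hw']
      | tmul b b' =>
        rw [superTmul_mul_odd _ _ ha, antipodeMulRight_tmul, antipodeMulRight_tmul, odd_mul _ _ ha,
          map_mul, hS]
        simp only [mul_assoc]
    rw [key, hw, AlgHom.commutes, Algebra.algebraMap_eq_smul_one, mul_smul_comm, smul_mul_assoc,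
      mul_one, antipodeMulRight_tmul]

/-- A super-Hopf algebra structure, whose axioms are checked on generators. -/
def SuperHopfAlgebra.ofGenerators (Δ : A →ₐ[ℂ] SuperTensor A A) (ε : A →ₐ[ℂ] ℂ) (S : A →ₗ[ℂ] A)
    (hΔ : ∀ a, Δ (parity a) = parity (Δ a)) (hε : ∀ a, ε (parity a) = ε a)
    (hS : ∀ a, S (parity a) = parity (S a)) (S_one : S 1 = 1)
    (even_mul : ∀ a b, parity a = a → S (a * b) = S b * S a)
    (odd_mul : ∀ a b, parity a = -a → S (a * b) = S (parity b) * S a)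
    {s : Set A} (hs : Algebra.adjoin ℂ s = ⊤)
    (coassoc : ∀ u ∈ s, superMap (AlgHom.id ℂ A) Δ algHom_id_parity hΔ (Δ u) =
      superAssoc (superMap Δ (AlgHom.id ℂ A) hΔ algHom_id_parity (Δ u)))
    (counit_left : ∀ u ∈ s, superLid ε hε (Δ u) = u)
    (counit_right : ∀ u ∈ s, superRid ε hε (Δ u) = u)
    (antipode_left : ∀ u ∈ s, antipodeMulLeft S (Δ u) = algebraMap ℂ A (ε u))
    (antipode_right : ∀ u ∈ s, antipodeMulRight S (Δ u) = algebraMap ℂ A (ε u)) :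
    SuperHopfAlgebra A where
  comul := (superOf A A).symm.toLinearMap ∘ₗ Δ.toLinearMap
  counit := ε.toLinearMap
  coassoc := by
    refine LinearMap.ext fun u => ?_
    exact (coassoc_of_adjoin_eq_top hΔ hΔ hs coassoc u).symm
  rTensor_counit_comp_comul := by
    refine LinearMap.ext fun u => (TensorProduct.lid ℂ A).injective ?_
    have h := DFunLike.congr_fun (AlgHom.ext_of_adjoin_eq_top
      (φ₁ := (superLid ε hε).comp Δ) (φ₂ := AlgHom.id ℂ A) hs counit_left) u
    exact h.trans (one_smul ℂ u).symm
  lTensor_counit_comp_comul := by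
    refine LinearMap.ext fun u => (TensorProduct.rid ℂ A).injective ?_
    have h := DFunLike.congr_fun (AlgHom.ext_of_adjoin_eq_top
      (φ₁ := (superRid ε hε).comp Δ) (φ₂ := AlgHom.id ℂ A) hs counit_right) u
    exact h.trans (one_smul ℂ u).symm
  comul_one := map_one Δ
  comul_mul := map_mul Δ
  comul_parity := hΔ
  counit_one := map_one ε
  counit_mul := map_mul ε
  counit_parity := hε
  antipode := S
  antipode_parity := hS
  antipode_left := by
    intro a
    change antipodeMulLeft S (Δ a) = algebraMap ℂ A (ε a)
    have ha : a ∈ Algebra.adjoin ℂ s := hs ▸ Algebra.mem_top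
    -- The elements satisfying the axiom are closed under sums and products and contain the scalars.
    induction ha using Algebra.adjoin_induction with
    | mem u hu => exact antipode_left u hu
    | algebraMap c =>
      rw [AlgHom.commutes, AlgHom.commutes, Algebra.algebraMap_eq_smul_one, map_smul,
        ← one_superTmul_one, antipodeMulLeft_tmul, S_one, mul_one,
        ← Algebra.algebraMap_eq_smul_one]
      rfl
    | add a b _ _ ha hb => rw [map_add, map_add, map_add, map_add, ha, hb]
    | mul a b _ _ ha hb =>
      rw [map_mul, antipodeMulLeft_mul hS even_mul odd_mul ha, hb, map_mul, map_mul,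
        Algebra.smul_def]
  antipode_right := by
    intro a
    change antipodeMulRight S (Δ a) = algebraMap ℂ A (ε a)
    have ha : a ∈ Algebra.adjoin ℂ s := hs ▸ Algebra.mem_top
    induction ha using Algebra.adjoin_induction with
    | mem u hu => exact antipode_right u hu
    | algebraMap c =>
      rw [AlgHom.commutes, AlgHom.commutes, Algebra.algebraMap_eq_smul_one, map_smul,
        ← one_superTmul_one, antipodeMulRight_tmul, S_one, mul_one,
        ← Algebra.algebraMap_eq_smul_one]
      rfl
    | add a b _ _ ha hb => rw [map_add, map_add, map_add, map_add, ha, hb]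
    | mul a b _ _ ha hb =>
      rw [map_mul, antipodeMulRight_mul hS even_mul odd_mul _ hb, ha, map_mul, map_mul,
        ← Algebra.commutes, Algebra.smul_def]

end Antipode

/-! ### Quantum spaces from data on generators -/

section Coaction

variable {A X : Type*} [Ring A] [Algebra ℂ A] [SuperAlgebra A] [Ring X] [Algebra ℂ X]
  [SuperAlgebra X]

/-- The comultiplication of a super-Hopf algebra, as an algebra homomorphism. -/
def SuperHopfAlgebra.comulHom (H : SuperHopfAlgebra A) : A →ₐ[ℂ] SuperTensor A A :=
  AlgHom.ofLinearMap ((superOf A A).toLinearMap ∘ₗ H.comul) H.comul_one H.comul_mul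

/-- The counit of a super-Hopf algebra, as an algebra homomorphism. -/
def SuperHopfAlgebra.counitHom (H : SuperHopfAlgebra A) : A →ₐ[ℂ] ℂ :=
  AlgHom.ofLinearMap H.counit H.counit_one H.counit_mul

theorem SuperHopfAlgebra.comulHom_parity (H : SuperHopfAlgebra A) (a : A) :
    H.comulHom (parity a) = parity (H.comulHom a) := H.comul_parity a

theorem SuperHopfAlgebra.counitHom_parity (H : SuperHopfAlgebra A) (a : A) :
    H.counitHom (parity a) = H.counitHom a := H.counit_parity a

/-- A left quantum space structure, whose axioms are checked on generators. -/
def LeftQuantumSpace.ofGenerators (H : SuperHopfAlgebra A) (δ : X →ₐ[ℂ] SuperTensor A X)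
    {s : Set X} (hs : Algebra.adjoin ℂ s = ⊤) (hδ : ∀ u, δ (parity u) = parity (δ u))
    (coassoc : ∀ u ∈ s, superMap (AlgHom.id ℂ A) δ algHom_id_parity hδ (δ u) =
      superAssoc (superMap H.comulHom (AlgHom.id ℂ X) H.comulHom_parity algHom_id_parity (δ u)))
    (counit : ∀ u ∈ s, superLid H.counitHom H.counitHom_parity (δ u) = u) :
    LeftQuantumSpace H X where
  coact := δ
  coact_parity := hδ
  coassoc := coassoc_of_adjoin_eq_top (Δ := H.comulHom) H.comulHom_parity hδ hs coassoc
  counit_coact u := DFunLike.congr_fun (AlgHom.ext_of_adjoin_eq_top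
      (φ₁ := (superLid H.counitHom H.counitHom_parity).comp δ) (φ₂ := AlgHom.id ℂ X) hs counit) u

end Coaction

/-! ### Product, antipode image and neutral element for points -/

namespace OSP

namespace Point

variable {r : ℂ}

/-- A point of `O(SP_q(1|2))` with values in a superalgebra is graded if `a, b, c, d` are even and
`α, δ` are odd. -/
structure Graded {A : Type*} [Ring A] [Algebra ℂ A] [SuperAlgebra A] (P : Point r A) : Prop where
  a : parity P.a = P.a
  b : parity P.b = P.b
  c : parity P.c = P.c
  d : parity P.d = P.d
  α : parity P.α = -P.α
  δ : parity P.δ = -P.δ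

section Graded

variable {A B : Type*} [Ring A] [Algebra ℂ A] [SuperAlgebra A] [Ring B] [Algebra ℂ B]
  [SuperAlgebra B] {P : Point r A} {Q : Point r B}

theorem Graded.γ (hP : P.Graded) : parity P.γ = -P.γ := by
  simp only [Point.γ, map_sub, map_smul, map_mul, hP.a, hP.δ, hP.c, hP.α, mul_neg, smul_neg]
  abel

theorem Graded.β (hP : P.Graded) : parity P.β = -P.β := by
  simp only [Point.β, map_sub, map_smul, map_mul, hP.b, hP.δ, hP.d, hP.α, mul_neg, neg_mul,
    smul_neg]
  abel

theorem Graded.e (hP : P.Graded) : parity P.e = P.e := by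
  simp only [Point.e, map_add, map_smul, map_mul, map_one, hP.b, hP.c, hP.δ, hP.α, neg_mul_neg]

/-- Products in the super tensor product, when the factor to be moved is a matrix entry. -/
theorem Graded.superTmul_mul (hQ : Q.Graded) (x x' : A) (y : B) :
    x ⊗ˢ Q.a * x' ⊗ˢ y = (x * x') ⊗ˢ (Q.a * y) ∧
    x ⊗ˢ Q.b * x' ⊗ˢ y = (x * x') ⊗ˢ (Q.b * y) ∧
    x ⊗ˢ Q.c * x' ⊗ˢ y = (x * x') ⊗ˢ (Q.c * y) ∧
    x ⊗ˢ Q.d * x' ⊗ˢ y = (x * x') ⊗ˢ (Q.d * y) ∧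
    x ⊗ˢ Q.e * x' ⊗ˢ y = (x * x') ⊗ˢ (Q.e * y) ∧
    x ⊗ˢ Q.α * x' ⊗ˢ y = (x * parity x') ⊗ˢ (Q.α * y) ∧
    x ⊗ˢ Q.β * x' ⊗ˢ y = (x * parity x') ⊗ˢ (Q.β * y) ∧
    x ⊗ˢ Q.γ * x' ⊗ˢ y = (x * parity x') ⊗ˢ (Q.γ * y) ∧
    x ⊗ˢ Q.δ * x' ⊗ˢ y = (x * parity x') ⊗ˢ (Q.δ * y) :=
  ⟨superTmul_mul_even _ _ hQ.a _,
    superTmul_mul_even _ _ hQ.b _,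
    superTmul_mul_even _ _ hQ.c _,
    superTmul_mul_even _ _ hQ.d _,
    superTmul_mul_even _ _ hQ.e _,
    superTmul_mul_odd _ _ hQ.α _,
    superTmul_mul_odd _ _ hQ.β _,
    superTmul_mul_odd _ _ hQ.γ _,
    superTmul_mul_odd _ _ hQ.δ _⟩

set_option maxHeartbeats 8000000 in
/-- The matrix product of two graded points is a point with values in the super tensor product. -/
def mul (hr : r ≠ 0) (P : Point r A) (Q : Point r B) (hP : P.Graded) (hQ : Q.Graded) :
    Point r (SuperTensor A B) := by
  refine
    { a := P.a ⊗ˢ Q.a + P.α ⊗ˢ Q.γ + P.b ⊗ˢ Q.c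
      b := P.a ⊗ˢ Q.b + P.α ⊗ˢ Q.β + P.b ⊗ˢ Q.d
      c := P.c ⊗ˢ Q.a + P.δ ⊗ˢ Q.γ + P.d ⊗ˢ Q.c
      d := P.c ⊗ˢ Q.b + P.δ ⊗ˢ Q.β + P.d ⊗ˢ Q.d
      α := P.a ⊗ˢ Q.α + P.α ⊗ˢ Q.e + P.b ⊗ˢ Q.δ
      δ := P.c ⊗ˢ Q.α + P.δ ⊗ˢ Q.e + P.d ⊗ˢ Q.δ
      ab := ?_, ac := ?_, aα := ?_, aδ := ?_, ad := ?_, bc := ?_, bd := ?_, bα := ?_, bδ := ?_,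
      cd := ?_, cα := ?_, cδ := ?_, dα := ?_, dδ := ?_, αδ := ?_, αα := ?_, δδ := ?_, superdet := ?_ }
  -- Each relation for the product becomes a bilinear identity in quadratic words of the two points.
  -- The two multiplication tables normalise both tensor factors, leaving a comparison of
  -- coefficients.
  all_goals
    simp only [mul_add, add_mul, hQ.superTmul_mul, hP.a, hP.b, hP.c, hP.d, hP.e, hP.α, hP.β, hP.γ,
      hP.δ, mul_neg]
    simp only [P.mul_table hr, Q.mul_table hr, add_superTmul, superTmul_add, sub_superTmul,
      superTmul_sub, neg_superTmul, superTmul_neg, smul_superTmul, superTmul_smul,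
      ← one_superTmul_one]
  all_goals match_scalars
  all_goals try field_simp
  all_goals try ring

-- The entries γ, e, β are polynomials in the generators, so their compatibility with the matrix
-- product is not built into `mul`. This and the next two results supply the middle row of the
-- product matrix.
set_option maxHeartbeats 1000000 in
theorem mul_γ (hr : r ≠ 0) (hP : P.Graded) (hQ : Q.Graded) :
    (mul hr P Q hP hQ).γ = P.γ ⊗ˢ Q.a + P.e ⊗ˢ Q.γ + P.β ⊗ˢ Q.c := by
  rw [Point.γ]
  simp only [Point.mul]
  simp only [mul_add, add_mul, hQ.superTmul_mul, hP.a, hP.b, hP.c, hP.d, hP.e, hP.α, hP.β, hP.γ,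
    hP.δ, mul_neg]
  simp only [P.mul_table hr, Q.mul_table hr, add_superTmul, superTmul_add, sub_superTmul,
    superTmul_sub, neg_superTmul, superTmul_neg, smul_superTmul, superTmul_smul,
    ← one_superTmul_one]
  all_goals match_scalars
  all_goals try field_simp
  all_goals try ring

set_option maxHeartbeats 1000000 in
theorem mul_e (hr : r ≠ 0) (hP : P.Graded) (hQ : Q.Graded) :
    (mul hr P Q hP hQ).e = P.γ ⊗ˢ Q.α + P.e ⊗ˢ Q.e + P.β ⊗ˢ Q.δ := by
  rw [Point.e]
  simp only [Point.mul]
  simp only [mul_add, add_mul, hQ.superTmul_mul, hP.a, hP.b, hP.c, hP.d, hP.e, hP.α, hP.β, hP.γ,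
    hP.δ, mul_neg]
  simp only [P.mul_table hr, Q.mul_table hr, add_superTmul, superTmul_add, sub_superTmul,
    superTmul_sub, neg_superTmul, superTmul_neg, smul_superTmul, superTmul_smul,
    ← one_superTmul_one]
  all_goals match_scalars
  all_goals try field_simp
  all_goals try ring

set_option maxHeartbeats 1000000 in
theorem mul_β (hr : r ≠ 0) (hP : P.Graded) (hQ : Q.Graded) :
    (mul hr P Q hP hQ).β = P.γ ⊗ˢ Q.b + P.e ⊗ˢ Q.β + P.β ⊗ˢ Q.d := by
  rw [Point.β]
  simp only [Point.mul]
  simp only [mul_add, add_mul, hQ.superTmul_mul, hP.a, hP.b, hP.c, hP.d, hP.e, hP.α, hP.β, hP.γ,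
    hP.δ, mul_neg]
  simp only [P.mul_table hr, Q.mul_table hr, add_superTmul, superTmul_add, sub_superTmul,
    superTmul_sub, neg_superTmul, superTmul_neg, smul_superTmul, superTmul_smul,
    ← one_superTmul_one]
  all_goals match_scalars
  all_goals try field_simp
  all_goals try ring

end Graded

/-- The antipode image of a point, as a point of the opposite algebra. The images of odd entries
carry a factor `√-1`, which turns a super-antihomomorphism into an antihomomorphism. -/
def op {R : Type*} [Ring R] [Algebra ℂ R] (hr : r ≠ 0) (P : Point r R) : Point r Rᵐᵒᵖ := by
  -- Two odd images contribute √-1 · √-1 = -1, exactly the sign separating a super-opposite product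
  -- from the ordinary opposite one.
  have hI : ∀ x y : R, Complex.I • x * Complex.I • y = -(x * y) := fun x y => by
    rw [smul_mul_smul_comm, Complex.I_mul_I, neg_one_smul]
  refine
    { a := .op P.d
      b := .op (-((r ^ 2)⁻¹ • P.b))
      c := .op (-(r ^ 2 • P.c))
      d := .op P.a
      α := .op (Complex.I • r⁻¹ • P.β)
      δ := .op (Complex.I • -(r • P.γ))
      ab := ?_, ac := ?_, aα := ?_, aδ := ?_, ad := ?_, bc := ?_, bd := ?_, bα := ?_, bδ := ?_,
      cd := ?_, cα := ?_, cδ := ?_, dα := ?_, dδ := ?_, αδ := ?_, αα := ?_, δδ := ?_, superdet := ?_ }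
  all_goals
    apply MulOpposite.unop_injective
    simp only [MulOpposite.unop_add, MulOpposite.unop_sub, MulOpposite.unop_neg,
      MulOpposite.unop_smul, MulOpposite.unop_mul, MulOpposite.unop_op, MulOpposite.unop_one, hI]
    simp only [smul_mul_assoc, mul_smul_comm, neg_mul, mul_neg, P.mul_table hr]
  all_goals match_scalars
  all_goals try field_simp
  all_goals try ring

/-- The value of the antipode on the dependent entry γ has to be computed from its defining
polynomial; the same is done for e and β below. -/
theorem op_γ {R : Type*} [Ring R] [Algebra ℂ R] (hr : r ≠ 0) (P : Point r R) :
    (P.op hr).γ = .op (Complex.I • -(r • P.δ)) := by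
  have hI : ∀ x y : R, Complex.I • x * Complex.I • y = -(x * y) := fun x y => by
    rw [smul_mul_smul_comm, Complex.I_mul_I, neg_one_smul]
  apply MulOpposite.unop_injective
  rw [Point.γ]
  simp only [op, MulOpposite.unop_add, MulOpposite.unop_sub,
    MulOpposite.unop_neg, MulOpposite.unop_smul, MulOpposite.unop_mul, MulOpposite.unop_op,
    MulOpposite.unop_one, hI]
  simp only [smul_mul_assoc, mul_smul_comm, neg_mul, mul_neg, P.mul_table hr]
  match_scalars
  all_goals try field_simp
  all_goals try ring

theorem op_e {R : Type*} [Ring R] [Algebra ℂ R] (hr : r ≠ 0) (P : Point r R) :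
    (P.op hr).e = .op (P.e) := by
  have hI : ∀ x y : R, Complex.I • x * Complex.I • y = -(x * y) := fun x y => by
    rw [smul_mul_smul_comm, Complex.I_mul_I, neg_one_smul]
  apply MulOpposite.unop_injective
  rw [Point.e]
  simp only [op, MulOpposite.unop_add, MulOpposite.unop_sub,
    MulOpposite.unop_neg, MulOpposite.unop_smul, MulOpposite.unop_mul, MulOpposite.unop_op,
    MulOpposite.unop_one, hI]
  simp only [smul_mul_assoc, mul_smul_comm, neg_mul, mul_neg, P.mul_table hr]
  match_scalars
  all_goals try field_simp
  all_goals try ring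

theorem op_β {R : Type*} [Ring R] [Algebra ℂ R] (hr : r ≠ 0) (P : Point r R) :
    (P.op hr).β = .op (Complex.I • r⁻¹ • P.α) := by
  have hI : ∀ x y : R, Complex.I • x * Complex.I • y = -(x * y) := fun x y => by
    rw [smul_mul_smul_comm, Complex.I_mul_I, neg_one_smul]
  apply MulOpposite.unop_injective
  rw [Point.β]
  simp only [op, MulOpposite.unop_add, MulOpposite.unop_sub,
    MulOpposite.unop_neg, MulOpposite.unop_smul, MulOpposite.unop_mul, MulOpposite.unop_op,
    MulOpposite.unop_one, hI]
  simp only [smul_mul_assoc, mul_smul_comm, neg_mul, mul_neg, P.mul_table hr]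
  match_scalars
  all_goals try field_simp
  all_goals try ring

/-- The neutral point. -/
def one (r : ℂ) : Point r ℂ where
  a := 1
  b := 0
  c := 0
  d := 1
  α := 0
  δ := 0
  ab := by simp
  ac := by simp
  aα := by simp
  aδ := by simp
  ad := by simp
  bc := by simp
  bd := by simp
  bα := by simp
  bδ := by simp
  cd := by simp
  cα := by simp
  cδ := by simp
  dα := by simp
  dδ := by simp
  αδ := by simp
  αα := by simp
  δδ := by simp
  superdet := by simp

end Point
end OSP

/-! ### The standard super-Hopf structure on the quantum supergroup -/

theorem adjoin_range_mk_eq_top {ι : Type*} (Rl : FreeAlgebra ℂ ι → FreeAlgebra ℂ ι → Prop) :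
    Algebra.adjoin ℂ (Set.range fun i => RingQuot.mkAlgHom ℂ Rl (FreeAlgebra.ι ℂ i)) = ⊤ := by
  have h := congrArg (Subalgebra.map (RingQuot.mkAlgHom ℂ Rl)) (FreeAlgebra.adjoin_range_ι ℂ ι)
  rw [AlgHom.map_adjoin, ← Set.range_comp, Algebra.map_top,
    (AlgHom.range_eq_top _).2 (RingQuot.mkAlgHom_surjective ℂ Rl)] at h
  exact h

namespace OSP

/-- The generators of `O(SP_q(1|2))`, as a point. -/
def point (r : ℂ) : Point r (Alg (r ^ 2) r) where
  a := elt _ r .a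
  b := elt _ r .b
  c := elt _ r .c
  d := elt _ r .d
  α := elt _ r .α
  δ := elt _ r .δ
  ab := by
    simpa only [elt, map_add, map_sub, map_neg, map_mul, map_smul, map_one] using mk_rel _ r .ab
  ac := by
    simpa only [elt, map_add, map_sub, map_neg, map_mul, map_smul, map_one] using mk_rel _ r .ac
  aα := by
    simpa only [elt, map_add, map_sub, map_neg, map_mul, map_smul, map_one] using mk_rel _ r .aα
  aδ := by
    simpa only [elt, map_add, map_sub, map_neg, map_mul, map_smul, map_one] using mk_rel _ r .aδ
  ad := by
    simpa only [elt, map_add, map_sub, map_neg, map_mul, map_smul, map_one] using mk_rel _ r .ad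
  bc := by
    simpa only [elt, map_add, map_sub, map_neg, map_mul, map_smul, map_one] using mk_rel _ r .bc
  bd := by
    simpa only [elt, map_add, map_sub, map_neg, map_mul, map_smul, map_one] using mk_rel _ r .bd
  bα := by
    simpa only [elt, map_add, map_sub, map_neg, map_mul, map_smul, map_one] using mk_rel _ r .bα
  bδ := by
    simpa only [elt, map_add, map_sub, map_neg, map_mul, map_smul, map_one] using mk_rel _ r .bδ
  cd := by
    simpa only [elt, map_add, map_sub, map_neg, map_mul, map_smul, map_one] using mk_rel _ r .cd
  cα := by
    simpa only [elt, map_add, map_sub, map_neg, map_mul, map_smul, map_one] using mk_rel _ r .cα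
  cδ := by
    simpa only [elt, map_add, map_sub, map_neg, map_mul, map_smul, map_one] using mk_rel _ r .cδ
  dα := by
    simpa only [elt, map_add, map_sub, map_neg, map_mul, map_smul, map_one] using mk_rel _ r .dα
  dδ := by
    simpa only [elt, map_add, map_sub, map_neg, map_mul, map_smul, map_one] using mk_rel _ r .dδ
  αδ := by
    simpa only [elt, map_add, map_sub, map_neg, map_mul, map_smul, map_one] using mk_rel _ r .αδ
  αα := by
    simpa only [elt, map_add, map_sub, map_neg, map_mul, map_smul, map_one] using mk_rel _ r .αα
  δδ := by
    simpa only [elt, map_add, map_sub, map_neg, map_mul, map_smul, map_one] using mk_rel _ r .δδ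
  superdet := by
    simpa only [elt, map_add, map_sub, map_neg, map_mul, map_smul, map_one] using mk_rel _ r .superdet

variable {r : ℂ}

/-- The image of a generator under a point. -/
def Point.val {R : Type*} [Ring R] [Algebra ℂ R] (P : Point r R) : Gen → R
  | .a => P.a
  | .b => P.b
  | .c => P.c
  | .d => P.d
  | .α => P.α
  | .δ => P.δ

/-- The algebra homomorphism defined by a point. -/
def Point.lift {R : Type*} [Ring R] [Algebra ℂ R] (P : Point r R) : Alg (r ^ 2) r →ₐ[ℂ] R :=
  RingQuot.liftAlgHom ℂ ⟨FreeAlgebra.lift ℂ P.val, fun u v h => by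
    cases h <;>
      simp only [gen, map_add, map_sub, map_neg, map_mul, map_smul, map_one,
        FreeAlgebra.lift_ι_apply, Point.val]
    · exact P.ab
    · exact P.ac
    · exact P.aα
    · exact P.aδ
    · exact P.ad
    · exact P.bc
    · exact P.bd
    · exact P.bα
    · exact P.bδ
    · exact P.cd
    · exact P.cα
    · exact P.cδ
    · exact P.dα
    · exact P.dδ
    · exact P.αδ
    · exact P.αα
    · exact P.δδ
    · exact P.superdet⟩

section Lift

variable {R : Type*} [Ring R] [Algebra ℂ R] (P : Point r R)

theorem Point.lift_elt (g : Gen) : P.lift (elt _ r g) = P.val g :=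
  (RingQuot.liftAlgHom_mkAlgHom_apply ℂ _ _ _).trans (by rw [FreeAlgebra.lift_ι_apply])

theorem Point.lift_a : P.lift (point r).a = P.a := P.lift_elt _

theorem Point.lift_b : P.lift (point r).b = P.b := P.lift_elt _

theorem Point.lift_c : P.lift (point r).c = P.c := P.lift_elt _

theorem Point.lift_d : P.lift (point r).d = P.d := P.lift_elt _

theorem Point.lift_α : P.lift (point r).α = P.α := P.lift_elt _

theorem Point.lift_δ : P.lift (point r).δ = P.δ := P.lift_elt _

theorem Point.lift_γ : P.lift (point r).γ = P.γ := by
  simp only [Point.γ, map_sub, map_smul, map_mul, lift_a, lift_c, lift_α, lift_δ]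

theorem Point.lift_β : P.lift (point r).β = P.β := by
  simp only [Point.β, map_sub, map_smul, map_mul, lift_b, lift_d, lift_α, lift_δ]

theorem Point.lift_e : P.lift (point r).e = P.e := by
  simp only [Point.e, map_add, map_smul, map_mul, map_one, lift_b, lift_c, lift_α, lift_δ]

end Lift

/-- The matrix of a point. -/
def Point.matrix {R : Type*} [Ring R] [Algebra ℂ R] (P : Point r R) : Matrix (Fin 3) (Fin 3) R :=
  !![P.a, P.α, P.b; P.γ, P.e, P.β; P.c, P.δ, P.d]

/-- The inverse of the matrix of a point. -/
def Point.invMatrix {R : Type*} [Ring R] [Algebra ℂ R] (P : Point r R) :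
    Matrix (Fin 3) (Fin 3) R :=
  !![P.d, r⁻¹ • P.β, -((r ^ 2)⁻¹ • P.b); -(r • P.δ), P.e, r⁻¹ • P.α;
    -(r ^ 2 • P.c), -(r • P.γ), P.a]

theorem T_eq : T (r ^ 2) r = (point r).matrix := rfl

section Matrix

variable {R : Type*} [Ring R] [Algebra ℂ R] (P : Point r R)

theorem Point.lift_matrix (i j : Fin 3) : P.lift ((point r).matrix i j) = P.matrix i j := by
  fin_cases i <;> fin_cases j
  exacts [P.lift_a, P.lift_α, P.lift_b, P.lift_γ, P.lift_e, P.lift_β, P.lift_c, P.lift_δ, P.lift_d]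

-- On matrix entries the right antipode axiom is this matrix identity, and the left one is the
-- reversed product that follows.
set_option maxHeartbeats 1000000 in
theorem Point.matrix_mul_invMatrix (hr : r ≠ 0) : P.matrix * P.invMatrix = 1 := by
  rw [Point.matrix, Point.invMatrix, Matrix.mul_fin_three, Matrix.one_fin_three]
  refine congrArg Matrix.of (Matrix.vec3_eq (Matrix.vec3_eq ?_ ?_ ?_) (Matrix.vec3_eq ?_ ?_ ?_)
    (Matrix.vec3_eq ?_ ?_ ?_))
  all_goals simp only [mul_neg, mul_smul_comm, P.mul_table hr]
  all_goals match_scalars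
  all_goals try field_simp
  all_goals try ring

set_option maxHeartbeats 1000000 in
theorem Point.invMatrix_mul_matrix (hr : r ≠ 0) : P.invMatrix * P.matrix = 1 := by
  rw [Point.matrix, Point.invMatrix, Matrix.mul_fin_three, Matrix.one_fin_three]
  refine congrArg Matrix.of (Matrix.vec3_eq (Matrix.vec3_eq ?_ ?_ ?_) (Matrix.vec3_eq ?_ ?_ ?_)
    (Matrix.vec3_eq ?_ ?_ ?_))
  all_goals simp only [neg_mul, smul_mul_assoc, P.mul_table hr]
  all_goals match_scalars
  all_goals try field_simp
  all_goals try ring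

theorem Point.one_matrix : (Point.one r).matrix = 1 := by
  rw [Point.matrix, Matrix.one_fin_three]
  simp [Point.γ, Point.β, Point.e, Point.one]

end Matrix

theorem Point.mul_matrix {A B : Type*} [Ring A] [Algebra ℂ A] [SuperAlgebra A] [Ring B]
    [Algebra ℂ B] [SuperAlgebra B] {P : Point r A} {Q : Point r B} (hr : r ≠ 0) (hP : P.Graded)
    (hQ : Q.Graded) (i j : Fin 3) :
    (mul hr P Q hP hQ).matrix i j = ∑ k, P.matrix i k ⊗ˢ Q.matrix k j := by
  rw [Fin.sum_univ_three]
  fin_cases i <;> fin_cases j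
  exacts [rfl, rfl, rfl, mul_γ hr hP hQ, mul_e hr hP hQ, mul_β hr hP hQ, rfl, rfl, rfl]

theorem graded_point (r : ℂ) : (point r).Graded where
  a := (parityHom_elt _ r .a).trans (one_smul ℂ _)
  b := (parityHom_elt _ r .b).trans (one_smul ℂ _)
  c := (parityHom_elt _ r .c).trans (one_smul ℂ _)
  d := (parityHom_elt _ r .d).trans (one_smul ℂ _)
  α := (parityHom_elt _ r .α).trans (neg_one_smul ℂ _)
  δ := (parityHom_elt _ r .δ).trans (neg_one_smul ℂ _)

/-- The entry t_ij has parity p(X_i) + p(X_j). In sums over an intermediate index k the sign of k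
occurs twice and cancels, which is why the comultiplication and the coactions are even. -/
theorem Point.Graded.matrix {A : Type*} [Ring A] [Algebra ℂ A] [SuperAlgebra A] {P : Point r A}
    (hP : P.Graded) (i j : Fin 3) :
    parity (P.matrix i j) = (SP.sign i * SP.sign j) • P.matrix i j := by
  have h : ∀ a : A, (-1 * -1 : ℂ) • a = a ∧ (-1 * 1 : ℂ) • a = -a ∧ (1 * -1 : ℂ) • a = -a ∧
      (1 * 1 : ℂ) • a = a := fun a => by simp
  fin_cases i <;> fin_cases j
  exacts [hP.a.trans (h _).1.symm, hP.α.trans (h _).2.1.symm, hP.b.trans (h _).1.symm,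
    hP.γ.trans (h _).2.2.1.symm, hP.e.trans (h _).2.2.2.symm, hP.β.trans (h _).2.2.1.symm,
    hP.c.trans (h _).1.symm, hP.δ.trans (h _).2.1.symm, hP.d.trans (h _).1.symm]

theorem adjoin_elt_eq_top (q r : ℂ) : Algebra.adjoin ℂ (Set.range (elt q r)) = ⊤ :=
  adjoin_range_mk_eq_top (Rel q r)

/-- All nine entries are taken as generators, although six suffice, because the structure maps have
uniform formulas on them. -/
theorem adjoin_matrix_eq_top :
    Algebra.adjoin ℂ (Set.range fun p : Fin 3 × Fin 3 => (point r).matrix p.1 p.2) = ⊤ := by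
  refine top_le_iff.1 ((adjoin_elt_eq_top (r ^ 2) r).symm.le.trans
    (Algebra.adjoin_mono ?_))
  rintro _ ⟨g, rfl⟩
  cases g
  exacts [⟨(0, 0), rfl⟩, ⟨(0, 2), rfl⟩, ⟨(2, 0), rfl⟩, ⟨(2, 2), rfl⟩, ⟨(0, 1), rfl⟩, ⟨(2, 1), rfl⟩]

/-- The comultiplication of `O(SP_q(1|2))`. -/
def comulHom (hr : r ≠ 0) :
    Alg (r ^ 2) r →ₐ[ℂ] SuperTensor (Alg (r ^ 2) r) (Alg (r ^ 2) r) :=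
  (Point.mul hr (point r) (point r) (graded_point r) (graded_point r)).lift

theorem comulHom_matrix (hr : r ≠ 0) (i j : Fin 3) :
    comulHom hr ((point r).matrix i j) = ∑ k, (point r).matrix i k ⊗ˢ (point r).matrix k j := by
  rw [comulHom, Point.lift_matrix, Point.mul_matrix]

theorem sign_mul_sign (i : Fin 3) : SP.sign i * SP.sign i = 1 := by
  fin_cases i <;> simp [SP.sign]

theorem comulHom_parity (hr : r ≠ 0) (a : Alg (r ^ 2) r) :
    comulHom hr (parity a) = parity (comulHom hr a) := by
  refine coact_parity_of_adjoin_eq_top adjoin_matrix_eq_top ?_ a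
  rintro _ ⟨⟨i, j⟩, rfl⟩
  simp only [(graded_point r).matrix, map_smul, comulHom_matrix, map_sum, parity_superTmul,
    smul_superTmul, superTmul_smul, smul_smul, Finset.smul_sum]
  refine Finset.sum_congr rfl fun k _ => ?_
  congr 1
  linear_combination (-(SP.sign i * SP.sign j)) * sign_mul_sign k

/-- The counit of `O(SP_q(1|2))`. -/
def counitHom (r : ℂ) : Alg (r ^ 2) r →ₐ[ℂ] ℂ := (Point.one r).lift

theorem counitHom_matrix (i j : Fin 3) :
    counitHom r ((point r).matrix i j) = if i = j then 1 else 0 := by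
  rw [counitHom, Point.lift_matrix, Point.one_matrix, Matrix.one_apply]

theorem counitHom_parity (a : Alg (r ^ 2) r) : counitHom r (parity a) = counitHom r a := by
  refine DFunLike.congr_fun (AlgHom.ext_of_adjoin_eq_top (φ₁ := (counitHom r).comp parity)
    (φ₂ := counitHom r) adjoin_matrix_eq_top ?_) a
  rintro _ ⟨⟨i, j⟩, rfl⟩
  simp only [AlgHom.comp_apply, (graded_point r).matrix, map_smul, counitHom_matrix]
  split_ifs with h
  · rw [h, sign_mul_sign, one_smul]
  · rw [smul_zero]

/-- The antihomomorphism underlying the antipode of `O(SP_q(1|2))`. -/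
def antipodeHom (hr : r ≠ 0) : Alg (r ^ 2) r →ₐ[ℂ] (Alg (r ^ 2) r)ᵐᵒᵖ := ((point r).op hr).lift

theorem superAntiHom_matrix (hr : r ≠ 0) (i j : Fin 3) :
    superAntiHom (antipodeHom hr) ((point r).matrix i j) = (point r).invMatrix i j := by
  have h := (graded_point r)
  -- On odd entries the factor √-1 placed in `Point.op` cancels the factor -√-1 of `superAntiHom`.
  have hI : ∀ a : Alg (r ^ 2) r, -(Complex.I • Complex.I • a) = a := fun a => by
    rw [smul_smul, Complex.I_mul_I, neg_one_smul, neg_neg]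
  have even : ∀ {a b : Alg (r ^ 2) r}, parity a = a → antipodeHom hr a = .op b →
      superAntiHom (antipodeHom hr) a = b := fun ha hb => by
    rw [superAntiHom_even _ ha, hb, MulOpposite.unop_op]
  have odd : ∀ {a b : Alg (r ^ 2) r}, parity a = -a →
      antipodeHom hr a = .op (Complex.I • b) → superAntiHom (antipodeHom hr) a = b :=
    fun ha hb => by rw [superAntiHom_odd _ ha, hb, MulOpposite.unop_op, hI]
  fin_cases i <;> fin_cases j
  exacts [even h.a (Point.lift_a _), odd h.α (Point.lift_α _), even h.b (Point.lift_b _),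
    odd h.γ ((Point.lift_γ _).trans ((point r).op_γ hr)),
    even h.e ((Point.lift_e _).trans ((point r).op_e hr)),
    odd h.β ((Point.lift_β _).trans ((point r).op_β hr)),
    even h.c (Point.lift_c _), odd h.δ (Point.lift_δ _), even h.d (Point.lift_d _)]

theorem antipodeHom_parity (hr : r ≠ 0) (a : Alg (r ^ 2) r) :
    (antipodeHom hr (parity a)).unop = parity (antipodeHom hr a).unop := by
  have h := AlgHom.ext_of_adjoin_eq_top (φ₁ := (antipodeHom hr).comp parity)
    (φ₂ := (AlgHom.op parity).comp (antipodeHom hr))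
    (adjoin_elt_eq_top (r ^ 2) r) ?_
  · exact congrArg MulOpposite.unop (DFunLike.congr_fun h a)
  have hG := graded_point r
  have h0 : ∀ g, antipodeHom hr (elt _ r g) = ((point r).op hr).val g := Point.lift_elt _
  rintro _ ⟨g, rfl⟩
  change antipodeHom hr (parityHom _ r (elt _ r g)) =
    .op (parity (antipodeHom hr (elt _ r g)).unop)
  rw [parityHom_elt, map_smul, h0]
  apply MulOpposite.unop_injective
  cases g <;>
    simp only [Point.val, Point.op, sign, MulOpposite.unop_op, MulOpposite.unop_smul,
      MulOpposite.unop_neg, map_neg,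
      map_smul, hG.a, hG.b, hG.c, hG.d, hG.β, hG.γ, one_smul, neg_one_smul, smul_neg, neg_neg]

/-- The standard super-Hopf structure on `O(SP_q(1|2))`. -/
def hopf (hr : r ≠ 0) : SuperHopfAlgebra (Alg (r ^ 2) r) :=
  SuperHopfAlgebra.ofGenerators (comulHom hr) (counitHom r) (superAntiHom (antipodeHom hr))
    (comulHom_parity hr) counitHom_parity (superAntiHom_parity _ (antipodeHom_parity hr))
    (by rw [superAntiHom_even _ (map_one _), map_one, MulOpposite.unop_one])
    (fun _ b ha => superAntiHom_even_mul _ ha b) (fun _ b ha => superAntiHom_odd_mul _ ha b)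
    adjoin_matrix_eq_top
    (by
      rintro _ ⟨⟨i, j⟩, rfl⟩
      simp only [comulHom_matrix, map_sum, superMap_tmul, AlgHom.id_apply, Fin.sum_univ_three,
        add_superTmul, superTmul_add, map_add, superAssoc_tmul]
      abel)
    (by
      rintro _ ⟨⟨i, j⟩, rfl⟩
      simp only [comulHom_matrix, map_sum, superLid_tmul, counitHom_matrix, ite_smul, one_smul,
        zero_smul, Finset.sum_ite_eq, Finset.mem_univ, if_true])
    (by
      rintro _ ⟨⟨i, j⟩, rfl⟩
      simp only [comulHom_matrix, map_sum, superRid_tmul, counitHom_matrix, ite_smul, one_smul,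
        zero_smul, Finset.sum_ite_eq', Finset.mem_univ, if_true])
    (by
      rintro _ ⟨⟨i, j⟩, rfl⟩
      simp only [comulHom_matrix, map_sum, antipodeMulLeft_tmul, superAntiHom_matrix,
        counitHom_matrix]
      rw [← Matrix.mul_apply, Point.invMatrix_mul_matrix _ hr, Matrix.one_apply]
      split_ifs <;> simp)
    (by
      rintro _ ⟨⟨i, j⟩, rfl⟩
      simp only [comulHom_matrix, map_sum, antipodeMulRight_tmul, superAntiHom_matrix,
        counitHom_matrix]
      rw [← Matrix.mul_apply, Point.matrix_mul_invMatrix _ hr, Matrix.one_apply]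
      split_ifs <;> simp)

theorem hopf_comulHom (hr : r ≠ 0) (a : Alg (r ^ 2) r) : (hopf hr).comulHom a = comulHom hr a :=
  rfl

theorem hopf_counitHom (hr : r ≠ 0) (a : Alg (r ^ 2) r) : (hopf hr).counitHom a = counitHom r a :=
  rfl

theorem isStandard_hopf (hr : r ≠ 0) : IsStandard (hopf hr) :=
  ⟨fun i j => (congrArg (superOf _ _).symm (comulHom_matrix hr i j)).trans
    (by simp only [map_sum, superOf_symm_superTmul, T_eq]),
    counitHom_matrix, superAntiHom_matrix hr⟩

end OSP

/-! ### Points of the quantum superspace and the standard coaction -/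

namespace SP

/-- Three elements of a complex algebra satisfying the defining relations of `O(SP_q^{1|2})`, where
`q = r ^ 2`. -/
structure Point (r : ℂ) (R : Type*) [Ring R] [Algebra ℂ R] where
  /-- the image of `ξ` -/
  ξ : R
  /-- the image of `x` -/
  x : R
  /-- the image of `η` -/
  η : R
  x_xi : x * ξ = r ^ 2 • (ξ * x)
  x_eta : x * η = (r ^ 2)⁻¹ • (η * x)
  eta_xi : η * ξ = -((r ^ 2) ^ 2 • (ξ * η)) + (r * (1 - r ^ 2)) • (x * x)
  xi_xi : ξ * ξ = 0
  eta_eta : η * η = 0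

variable {r : ℂ}

namespace Point

variable {R : Type*} [Ring R] [Algebra ℂ R] (Y : Point r R)

/-- This reorients the relation so that all rewriting leads to the order ξ, x, η. -/
theorem eta_x (hr : r ≠ 0) : Y.η * Y.x = r ^ 2 • (Y.x * Y.η) := by
  rw [Y.x_eta, smul_smul, mul_inv_cancel₀ (pow_ne_zero _ hr), one_smul]

/-- The coordinates of a point. -/
def val (Y : Point r R) : Fin 3 → R := ![Y.ξ, Y.x, Y.η]

/-- The algebra homomorphism defined by a point. -/
def lift : Alg (r ^ 2) r →ₐ[ℂ] R :=
  RingQuot.liftAlgHom ℂ ⟨FreeAlgebra.lift ℂ Y.val, fun u v h => by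
    cases h <;>
      simp only [gen, map_add, map_neg, map_mul, map_smul, map_zero, FreeAlgebra.lift_ι_apply, val,
        Matrix.cons_val_zero, Matrix.cons_val_one, Matrix.cons_val]
    · exact Y.x_xi
    · exact Y.x_eta
    · exact Y.eta_xi
    · exact Y.xi_xi
    · exact Y.eta_eta⟩

theorem lift_coord (i : Fin 3) : Y.lift (coord _ r i) = Y.val i :=
  (RingQuot.liftAlgHom_mkAlgHom_apply ℂ _ _ _).trans (by rw [FreeAlgebra.lift_ι_apply])

/-- A point with values in a superalgebra is graded if `x` is even and `ξ, η` are odd. -/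
structure Graded {X : Type*} [Ring X] [Algebra ℂ X] [SuperAlgebra X] (Y : Point r X) : Prop where
  ξ : parity Y.ξ = -Y.ξ
  x : parity Y.x = Y.x
  η : parity Y.η = -Y.η

end Point

/-- The coordinates of `O(SP_q^{1|2})`, as a point. -/
def point (r : ℂ) : Point r (Alg (r ^ 2) r) where
  ξ := coord _ r 0
  x := coord _ r 1
  η := coord _ r 2
  x_xi := by simpa only [coord, map_mul, map_smul] using mk_rel _ r .x_xi
  x_eta := by simpa only [coord, map_mul, map_smul] using mk_rel _ r .x_eta
  eta_xi := by
    simpa only [coord, map_add, map_neg, map_mul, map_smul] using mk_rel _ r .eta_xi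
  xi_xi := by simpa only [coord, map_mul, map_zero] using mk_rel _ r .xi_xi
  eta_eta := by simpa only [coord, map_mul, map_zero] using mk_rel _ r .eta_eta

theorem graded_point (r : ℂ) : (point r).Graded where
  ξ := (parityHom_coord _ r 0).trans (neg_one_smul ℂ _)
  x := (parityHom_coord _ r 1).trans (one_smul ℂ _)
  η := (parityHom_coord _ r 2).trans (neg_one_smul ℂ _)

theorem coord_eq (i : Fin 3) : coord (r ^ 2) r i = (point r).val i := by
  fin_cases i <;> rfl

theorem parity_coord (q r : ℂ) (i : Fin 3) : parity (coord q r i) = sign i • coord q r i :=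
  parityHom_coord q r i

theorem adjoin_coord_eq_top (q r : ℂ) : Algebra.adjoin ℂ (Set.range (coord q r)) = ⊤ :=
  adjoin_range_mk_eq_top (Rel q r)

section Coaction

variable {A X : Type*} [Ring A] [Algebra ℂ A] [SuperAlgebra A] [Ring X] [Algebra ℂ X]
  [SuperAlgebra X] {P : OSP.Point r A} {Y : Point r X}

theorem Point.Graded.superTmul_mul (hY : Y.Graded) (a a' : A) (y : X) :
    a ⊗ˢ Y.ξ * a' ⊗ˢ y = (a * parity a') ⊗ˢ (Y.ξ * y) ∧
    a ⊗ˢ Y.x * a' ⊗ˢ y = (a * a') ⊗ˢ (Y.x * y) ∧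
    a ⊗ˢ Y.η * a' ⊗ˢ y = (a * parity a') ⊗ˢ (Y.η * y) :=
  ⟨superTmul_mul_odd _ _ hY.ξ _, superTmul_mul_even _ _ hY.x _, superTmul_mul_odd _ _ hY.η _⟩

set_option maxHeartbeats 4000000 in
/-- The action of a graded point of `O(SP_q(1|2))` on a graded point of `O(SP_q^{1|2})`. -/
def Point.act (hr : r ≠ 0) (P : OSP.Point r A) (Y : Point r X) (hP : P.Graded) (hY : Y.Graded) :
    Point r (SuperTensor A X) := by
  refine
    { ξ := P.a ⊗ˢ Y.ξ + P.α ⊗ˢ Y.x + P.b ⊗ˢ Y.η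
      x := P.γ ⊗ˢ Y.ξ + P.e ⊗ˢ Y.x + P.β ⊗ˢ Y.η
      η := P.c ⊗ˢ Y.ξ + P.δ ⊗ˢ Y.x + P.d ⊗ˢ Y.η
      x_xi := ?_, x_eta := ?_, eta_xi := ?_, xi_xi := ?_, eta_eta := ?_ }
  all_goals
    simp only [mul_add, add_mul, hY.superTmul_mul, hP.a, hP.b, hP.c, hP.d, hP.e, hP.α, hP.β, hP.γ,
      hP.δ, mul_neg]
    simp only [P.mul_table hr, Y.x_xi, Y.eta_x hr, Y.eta_xi, Y.xi_xi, Y.eta_eta, add_superTmul,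
      superTmul_add, sub_superTmul, superTmul_sub, neg_superTmul, superTmul_neg, smul_superTmul,
      superTmul_smul, superTmul_zero]
  all_goals match_scalars
  all_goals try field_simp
  all_goals try ring

theorem Point.act_val (hr : r ≠ 0) (hP : P.Graded) (hY : Y.Graded) (i : Fin 3) :
    (Point.act hr P Y hP hY).val i = ∑ k, P.matrix i k ⊗ˢ Y.val k := by
  rw [Fin.sum_univ_three]
  fin_cases i <;> rfl

end Coaction

/-- The coaction of `O(SP_q(1|2))` on `O(SP_q^{1|2})`, as an algebra homomorphism. -/
def coactHom (hr : r ≠ 0) : Alg (r ^ 2) r →ₐ[ℂ] SuperTensor (OSP.Alg (r ^ 2) r) (Alg (r ^ 2) r) :=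
  (Point.act hr (OSP.point r) (point r) (OSP.graded_point r) (graded_point r)).lift

theorem coactHom_coord (hr : r ≠ 0) (i : Fin 3) :
    coactHom hr (coord _ r i) = ∑ k, (OSP.point r).matrix i k ⊗ˢ coord _ r k := by
  rw [coactHom, Point.lift_coord, Point.act_val]
  simp only [coord_eq]

theorem coactHom_parity (hr : r ≠ 0) (u : Alg (r ^ 2) r) :
    coactHom hr (parity u) = parity (coactHom hr u) := by
  refine coact_parity_of_adjoin_eq_top (adjoin_coord_eq_top _ r) ?_ u
  rintro _ ⟨i, rfl⟩
  simp only [parity_coord, (OSP.graded_point r).matrix, map_smul, coactHom_coord, map_sum,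
    parity_superTmul, smul_superTmul, superTmul_smul, smul_smul, Finset.smul_sum]
  refine Finset.sum_congr rfl fun k _ => ?_
  congr 1
  linear_combination (-sign i) * OSP.sign_mul_sign k

/-- The standard structure of left quantum space on `O(SP_q^{1|2})`. -/
def coaction (hr : r ≠ 0) : LeftQuantumSpace (OSP.hopf hr) (Alg (r ^ 2) r) :=
  LeftQuantumSpace.ofGenerators (OSP.hopf hr) (coactHom hr) (adjoin_coord_eq_top _ r)
    (coactHom_parity hr)
    (by
      rintro _ ⟨i, rfl⟩
      simp only [coactHom_coord, map_sum, superMap_tmul, AlgHom.id_apply, OSP.hopf_comulHom,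
        OSP.comulHom_matrix, Fin.sum_univ_three, add_superTmul, superTmul_add, map_add,
        superAssoc_tmul]
      abel)
    (by
      rintro _ ⟨i, rfl⟩
      simp only [coactHom_coord, map_sum, superLid_tmul, OSP.hopf_counitHom, OSP.counitHom_matrix,
        ite_smul, one_smul, zero_smul, Finset.sum_ite_eq, Finset.mem_univ, if_true])

theorem isStandardCoaction_coaction (hr : r ≠ 0) : OSP.IsStandardCoaction (coaction hr) :=
  fun i => (coactHom_coord hr i).trans (by simp only [map_sum, superOf_tmul, OSP.T_eq])

end SP

/-! ### Bimodules that are free from the right -/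

section RightFreeForm

variable {X ι : Type} [Ring X] [Algebra ℂ X] [Fintype ι] [DecidableEq ι]

/-- The free right module `X^ι` of column vectors, considered as a bimodule through a
representation `ρ` of `X` by matrices over `X`. -/
def RightFreeForm (_ρ : X →ₐ[ℂ] Matrix ι ι X) : Type := ι → X

variable (ρ : X →ₐ[ℂ] Matrix ι ι X)

namespace RightFreeForm

instance : AddCommGroup (RightFreeForm ρ) := inferInstanceAs (AddCommGroup (ι → X))

instance : Module ℂ (RightFreeForm ρ) := inferInstanceAs (Module ℂ (ι → X))

instance : Module Xᵐᵒᵖ (RightFreeForm ρ) := inferInstanceAs (Module Xᵐᵒᵖ (ι → X))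

instance : IsScalarTower ℂ Xᵐᵒᵖ (RightFreeForm ρ) :=
  inferInstanceAs (IsScalarTower ℂ Xᵐᵒᵖ (ι → X))

instance : Module X (RightFreeForm ρ) where
  smul u ω := (ρ u).mulVec ω
  one_smul ω := (congrArg (Matrix.mulVec · ω) (map_one ρ)).trans (Matrix.one_mulVec _)
  mul_smul u v ω := (congrArg (Matrix.mulVec · ω) (map_mul ρ u v)).trans
    (Matrix.mulVec_mulVec _ _ _).symm
  smul_zero u := Matrix.mulVec_zero (ρ u)
  smul_add u ω ω' := Matrix.mulVec_add (ρ u) ω ω'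
  add_smul u v ω := (congrArg (Matrix.mulVec · ω) (map_add ρ u v)).trans
    (Matrix.add_mulVec _ _ _)
  zero_smul ω := (congrArg (Matrix.mulVec · ω) (map_zero ρ)).trans (Matrix.zero_mulVec _)

variable {ρ}

/-- The coefficients of a form with respect to the standard basis. -/
def coeff (ω : RightFreeForm ρ) (i : ι) : X := ω i

@[ext]
theorem ext {ω ω' : RightFreeForm ρ} (h : ∀ i, ω.coeff i = ω'.coeff i) : ω = ω' := funext h

theorem coeff_add (ω ω' : RightFreeForm ρ) (i : ι) :
    (ω + ω').coeff i = ω.coeff i + ω'.coeff i := rfl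

theorem coeff_sub (ω ω' : RightFreeForm ρ) (i : ι) :
    (ω - ω').coeff i = ω.coeff i - ω'.coeff i := rfl

theorem coeff_neg (ω : RightFreeForm ρ) (i : ι) : (-ω).coeff i = -ω.coeff i := rfl

theorem coeff_zero (i : ι) : (0 : RightFreeForm ρ).coeff i = 0 := rfl

theorem coeff_smul (c : ℂ) (ω : RightFreeForm ρ) (i : ι) : (c • ω).coeff i = c • ω.coeff i := rfl

theorem coeff_right (ω : RightFreeForm ρ) (u : X) (i : ι) : (ω <• u).coeff i = ω.coeff i * u := rfl

theorem coeff_left (u : X) (ω : RightFreeForm ρ) (i : ι) :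
    (u •> ω).coeff i = ∑ j, ρ u i j * ω.coeff j := rfl

instance : SMulCommClass X Xᵐᵒᵖ (RightFreeForm ρ) where
  smul_comm u v ω := by
    ext i
    obtain ⟨v, rfl⟩ := MulOpposite.op_surjective v
    simp only [coeff_left, coeff_right, Finset.sum_mul, mul_assoc]

instance : IsScalarTower ℂ X (RightFreeForm ρ) where
  smul_assoc c u ω := by
    ext i
    simp only [coeff_left, coeff_smul, map_smul, Matrix.smul_apply, smul_mul_assoc, Finset.smul_sum]

variable (ρ) in
/-- The standard basis of the right module `X^ι`. -/
def basis : Module.Basis ι Xᵐᵒᵖ (RightFreeForm ρ) :=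
  Module.Basis.ofEquivFun
    { toFun := fun ω i => .op (ω.coeff i)
      invFun := fun f i => (f i).unop
      map_add' := fun _ _ => rfl
      map_smul' := fun _ _ => rfl
      left_inv := fun _ => rfl
      right_inv := fun _ => rfl }

theorem basis_repr (ω : RightFreeForm ρ) (i : ι) : (basis ρ).repr ω i = .op (ω.coeff i) := by
  rw [basis, Module.Basis.ofEquivFun_repr_apply]
  rfl

theorem coeff_basis (i j : ι) : (basis ρ i).coeff j = if i = j then 1 else 0 := by
  have h := (basis ρ).repr_self_apply i j
  rw [basis_repr] at h
  have h' := congrArg MulOpposite.unop h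
  rw [MulOpposite.unop_op] at h'
  rw [h']
  split_ifs <;> rfl

end RightFreeForm

end RightFreeForm

/-! ### The left action on one-forms -/

namespace SP

variable {r : ℂ}

theorem induction {q r : ℂ} {p : Alg q r → Prop} (u : Alg q r) (coord : ∀ i, p (coord q r i))
    (algebraMap : ∀ c, p (algebraMap ℂ _ c)) (add : ∀ u v, p u → p v → p (u + v))
    (mul : ∀ u v, p u → p v → p (u * v)) : p u := by
  have hu : u ∈ Algebra.adjoin ℂ (Set.range (SP.coord q r)) :=
    (adjoin_coord_eq_top q r).symm ▸ Algebra.mem_top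
  induction hu using Algebra.adjoin_induction with
  | mem u hu => obtain ⟨i, rfl⟩ := hu; exact coord i
  | algebraMap c => exact algebraMap c
  | add u v _ _ hu hv => exact add u v hu hv
  | mul u v _ _ hu hv => exact mul u v hu hv

set_option maxHeartbeats 4000000 in
/-- The matrices describing the left action of the coordinates on the basis `dξ, dx, dη`. -/
def Point.leftMatrix {X : Type*} [Ring X] [Algebra ℂ X] (hr : r ≠ 0) (Y : Point r X) :
    Point r (Matrix (Fin 3) (Fin 3) X) := by
  -- Column j holds the coefficients of u · dX_j in the basis dξ, dx, dη, read off from (13) after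
  -- the substitution. The two factors √-1 in the term dx · x turn its sign around.
  refine
    { ξ := !![Y.ξ, (1 - (r ^ 4)⁻¹) • Y.x, ((1 - (r ^ 4)⁻¹) * (1 + (r ^ 2)⁻¹)) • Y.η;
          0, (-(r ^ 2)⁻¹) • Y.ξ, ((1 - (r ^ 4)⁻¹) * r⁻¹) • Y.x; 0, 0, (r ^ 4)⁻¹ • Y.ξ]
      x := !![(r ^ 2)⁻¹ • Y.x, ((1 - (r ^ 4)⁻¹) * r⁻¹) • Y.η, 0;
          0, (r ^ 2)⁻¹ • Y.x, ((r ^ 4)⁻¹ - 1) • Y.η; 0, 0, (r ^ 2)⁻¹ • Y.x]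
      η := !![(r ^ 4)⁻¹ • Y.η, 0, 0; 0, (-(r ^ 2)⁻¹) • Y.η, 0; 0, 0, Y.η]
      x_xi := ?_, x_eta := ?_, eta_xi := ?_, xi_xi := ?_, eta_eta := ?_ }
  all_goals
    ext i j
    fin_cases i <;> fin_cases j
  all_goals
    simp [Matrix.mul_apply, Fin.sum_univ_three, Y.x_xi, Y.eta_x hr, Y.eta_xi, Y.xi_xi, Y.eta_eta]
  all_goals match_scalars
  all_goals try field_simp
  all_goals try ring

/-- The representation describing the left action of `O(SP_q^{1|2})` on one-forms. -/
def leftRep (hr : r ≠ 0) : Alg (r ^ 2) r →ₐ[ℂ] Matrix (Fin 3) (Fin 3) (Alg (r ^ 2) r) :=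
  ((point r).leftMatrix hr).lift

end SP

/-! ### The differential and the calculus Γ₋ -/

namespace SP

variable {r : ℂ}

section Differential

variable (hr : r ≠ 0)

theorem leftRep_coord (i : Fin 3) :
    leftRep hr (coord _ r i) = ((point r).leftMatrix hr).val i :=
  Point.lift_coord _ i

/-- The left action twisted by the grading automorphism. -/
def twistedRep (hr : r ≠ 0) : Alg (r ^ 2) r →ₐ[ℂ] Matrix (Fin 3) (Fin 3) (Alg (r ^ 2) r) :=
  (leftRep hr).comp parity

theorem twistedRep_coord (i : Fin 3) :
    twistedRep hr (coord _ r i) = sign i • ((point r).leftMatrix hr).val i := by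
  rw [twistedRep, AlgHom.comp_apply, parity_coord, map_smul, leftRep_coord]

set_option maxHeartbeats 4000000 in
/-- The coordinates together with their differentials. -/
def diffPoint (hr : r ≠ 0) :
    Point r (TrivSqZeroExt (Alg (r ^ 2) r) (RightFreeForm (twistedRep hr))) := by
  -- With the left action twisted by the grading, (u + du)(v + dv) has form part (du) v + τ(u) dv.
  -- Thus multiplicativity in the square-zero extension is the graded Leibniz rule.
  have h0 := twistedRep_coord hr 0
  have h1 := twistedRep_coord hr 1
  have h2 := twistedRep_coord hr 2
  simp only [coord_eq, Point.val, Matrix.cons_val_zero, Matrix.cons_val_one, Matrix.cons_val,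
    sign, neg_one_smul, one_smul] at h0 h1 h2
  refine
    { ξ := .inl (point r).ξ + .inr (RightFreeForm.basis _ 0)
      x := .inl (point r).x + .inr (RightFreeForm.basis _ 1)
      η := .inl (point r).η + .inr (RightFreeForm.basis _ 2)
      x_xi := ?_, x_eta := ?_, eta_xi := ?_, xi_xi := ?_, eta_eta := ?_ }
  all_goals
    apply TrivSqZeroExt.ext
  -- The goals alternate between the function part, which is a relation of X, and the form part,
  -- which is its differential. The latter are postponed and treated together.
  · simpa using (point r).x_xi
  rotate_left
  · simpa using (point r).x_eta
  rotate_left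
  · simpa using (point r).eta_xi
  rotate_left
  · simpa using (point r).xi_xi
  rotate_left
  · simpa using (point r).eta_eta
  all_goals
    ext i
    simp only [TrivSqZeroExt.snd_add, TrivSqZeroExt.snd_mul, TrivSqZeroExt.snd_smul,
      TrivSqZeroExt.snd_neg, TrivSqZeroExt.snd_zero, TrivSqZeroExt.fst_add, TrivSqZeroExt.fst_inl,
      TrivSqZeroExt.fst_inr, TrivSqZeroExt.snd_inl, TrivSqZeroExt.snd_inr, add_zero, zero_add,
      RightFreeForm.coeff_add, RightFreeForm.coeff_smul, RightFreeForm.coeff_neg,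
      RightFreeForm.coeff_zero, RightFreeForm.coeff_left, RightFreeForm.coeff_right,
      RightFreeForm.coeff_basis, h0, h1, h2]
    fin_cases i
  all_goals simp [Fin.sum_univ_three, Point.leftMatrix]
  all_goals match_scalars
  all_goals try field_simp
  all_goals try ring

/-- The homomorphism `u ↦ u + du`. -/
def diffHom (hr : r ≠ 0) :
    Alg (r ^ 2) r →ₐ[ℂ] TrivSqZeroExt (Alg (r ^ 2) r) (RightFreeForm (twistedRep hr)) :=
  (diffPoint hr).lift

/-- Knowing that the function part of u + du is u itself turns multiplicativity into the Leibniz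
rule. -/
theorem fst_diffHom (u : Alg (r ^ 2) r) : (diffHom hr u).fst = u := by
  refine DFunLike.congr_fun (AlgHom.ext_of_adjoin_eq_top
    (φ₁ := (TrivSqZeroExt.fstHom ℂ _ _).comp (diffHom hr)) (φ₂ := AlgHom.id ℂ _)
    (adjoin_coord_eq_top _ r) ?_) u
  rintro _ ⟨i, rfl⟩
  change (diffHom hr (coord _ r i)).fst = coord _ r i
  rw [diffHom, Point.lift_coord]
  fin_cases i <;> simp [diffPoint, Point.val, point]

/-- The differential. -/
def diff (hr : r ≠ 0) : Alg (r ^ 2) r →ₗ[ℂ] RightFreeForm (leftRep hr) where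
  -- The twisted and untwisted modules share their underlying space and right action, so the form
  -- part can be reread in the untwisted one.
  toFun u := (diffHom hr u).snd
  map_add' u v := congrArg TrivSqZeroExt.snd (map_add (diffHom hr) u v)
  map_smul' c u := congrArg TrivSqZeroExt.snd (map_smul (diffHom hr) c u)

theorem diff_coord (i : Fin 3) : diff hr (coord _ r i) = RightFreeForm.basis _ i := by
  change (diffHom hr (coord _ r i)).snd = RightFreeForm.basis _ i
  rw [diffHom, Point.lift_coord]
  fin_cases i <;> simp [diffPoint, Point.val]

theorem diff_mul (u v : Alg (r ^ 2) r) :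
    diff hr (u * v) = diff hr u <• v + parity u •> diff hr v := by
  have h : diff hr (u * v) = (diffHom hr u * diffHom hr v).snd :=
    congrArg TrivSqZeroExt.snd (map_mul (diffHom hr) u v)
  rw [h, TrivSqZeroExt.snd_mul, fst_diffHom, fst_diffHom, add_comm]
  -- The twisted left action of u is by definition the original action of `parity u`.
  rfl

theorem diff_algebraMap (c : ℂ) : diff hr (algebraMap ℂ _ c) = 0 := by
  change (diffHom hr (algebraMap ℂ _ c)).snd = 0
  rw [AlgHom.commutes]
  rfl

/-- The grading of one-forms: `dx` is odd, `dξ` and `dη` are even. -/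
def formParity (hr : r ≠ 0) : RightFreeForm (leftRep hr) →ₗ[ℂ] RightFreeForm (leftRep hr) where
  toFun ω i := -sign i • parity (ω.coeff i)
  map_add' ω ω' := by
    ext i
    change -sign i • parity (ω.coeff i + ω'.coeff i) =
      -sign i • parity (ω.coeff i) + -sign i • parity (ω'.coeff i)
    rw [map_add, smul_add]
  map_smul' c ω := by
    ext i
    change -sign i • parity (c • ω.coeff i) = c • (-sign i • parity (ω.coeff i))
    rw [map_smul, smul_comm]

theorem coeff_formParity (ω : RightFreeForm (leftRep hr)) (i : Fin 3) :
    (formParity hr ω).coeff i = -sign i • parity (ω.coeff i) := rfl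

theorem formParity_formParity (ω : RightFreeForm (leftRep hr)) :
    formParity hr (formParity hr ω) = ω := by
  ext i
  rw [coeff_formParity, coeff_formParity, map_smul, parity_parity, smul_smul, neg_mul_neg,
    OSP.sign_mul_sign, one_smul]

theorem formParity_right (u : Alg (r ^ 2) r) (ω : RightFreeForm (leftRep hr)) :
    formParity hr (ω <• u) = formParity hr ω <• parity u := by
  ext i
  rw [coeff_formParity, RightFreeForm.coeff_right, RightFreeForm.coeff_right, coeff_formParity,
    map_mul, smul_mul_assoc]

/-- Coordinates suffice, as both sides are compatible with products in u. There it holds because the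
(j, k) entry of the matrix of X_i has parity p(X_i) + p(X_j) + p(X_k). -/
theorem formParity_left (u : Alg (r ^ 2) r) (ω : RightFreeForm (leftRep hr)) :
    formParity hr (u •> ω) = parity u •> formParity hr ω := by
  induction u using SP.induction generalizing ω with
  | coord i =>
    have hG := graded_point r
    ext j
    rw [parity_coord, smul_assoc, RightFreeForm.coeff_smul]
    simp only [coeff_formParity, RightFreeForm.coeff_left, leftRep_coord, Fin.sum_univ_three]
    fin_cases i <;> fin_cases j <;>
      simp [Point.val, Point.leftMatrix, sign, hG.ξ, hG.x, hG.η]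
  | algebraMap c =>
    rw [AlgHom.commutes, algebraMap_smul, algebraMap_smul, map_smul]
  | add u v hu hv => rw [add_smul, map_add, map_add, add_smul, hu, hv]
  | mul u v hu hv => rw [mul_smul, hu, hv, map_mul, mul_smul]

theorem formParity_diff (u : Alg (r ^ 2) r) : formParity hr (diff hr u) = -diff hr (parity u) := by
  induction u using SP.induction with
  | coord i =>
    ext j
    rw [parity_coord, map_smul, diff_coord, coeff_formParity, RightFreeForm.coeff_neg,
      RightFreeForm.coeff_smul, RightFreeForm.coeff_basis]
    split_ifs with h
    · rw [h, map_one, neg_smul]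
    · rw [map_zero, smul_zero, smul_zero, neg_zero]
  | algebraMap c => rw [AlgHom.commutes, diff_algebraMap, map_zero, neg_zero]
  | add u v hu hv => rw [map_add, map_add, map_add, map_add, neg_add, hu, hv]
  | mul u v hu hv =>
    rw [diff_mul, map_add, formParity_right, formParity_left, hu, hv, map_mul, diff_mul, neg_add,
      smul_neg, smul_neg]

/-- The second calculus `Γ₋` over `O(SP_q^{1|2})`. -/
def minusCalculus (hr : r ≠ 0) : SuperCalculus (Alg (r ^ 2) r) where
  Form := RightFreeForm (leftRep hr)
  formParity := formParity hr
  formParity_formParity := formParity_formParity hr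
  formParity_left := formParity_left hr
  formParity_right := formParity_right hr
  d := diff hr
  formParity_d := formParity_diff hr
  leibniz := diff_mul hr
  span_eq_top := by
    refine Submodule.eq_top_iff'.2 fun ω => ?_
    rw [← (RightFreeForm.basis (leftRep hr)).sum_repr ω]
    refine Submodule.sum_mem _ fun i _ => Submodule.subset_span
      ⟨1, coord _ r i, ω.coeff i, ?_⟩
    rw [one_smul, diff_coord, RightFreeForm.basis_repr]

/-- The differentials of the coordinates form a basis of the right module of one-forms. -/
def minusBasis (hr : r ≠ 0) : Module.Basis (Fin 3) (Alg (r ^ 2) r)ᵐᵒᵖ (minusCalculus hr).Form :=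
  RightFreeForm.basis (leftRep hr)

theorem minusBasis_apply (i : Fin 3) :
    minusBasis hr i = (minusCalculus hr).d (coord _ r i) := (diff_coord hr i).symm

end Differential

/-- The commutation relations of the second calculus, for `q = r ^ 2`. -/
structure MinusRelations {X Γ : Type*} [Ring X] [AddCommGroup Γ] [Module ℂ Γ] [Module X Γ]
    [Module Xᵐᵒᵖ Γ] (r : ℂ) (x ξ η : X) (dx dξ dη : Γ) : Prop where
  ξ_dξ : ξ •> dξ = dξ <• ξ
  ξ_dx : ξ •> dx = (1 - (r ^ 4)⁻¹) • (dξ <• x) - (r ^ 2)⁻¹ • (dx <• ξ)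
  ξ_dη : ξ •> dη = ((1 - (r ^ 4)⁻¹) * (1 + (r ^ 2)⁻¹)) • (dξ <• η) +
    ((1 - (r ^ 4)⁻¹) * r⁻¹) • (dx <• x) + (r ^ 4)⁻¹ • (dη <• ξ)
  x_dξ : x •> dξ = (r ^ 2)⁻¹ • (dξ <• x)
  x_dx : x •> dx = ((1 - (r ^ 4)⁻¹) * r⁻¹) • (dξ <• η) + (r ^ 2)⁻¹ • (dx <• x)
  x_dη : x •> dη = ((r ^ 4)⁻¹ - 1) • (dx <• η) + (r ^ 2)⁻¹ • (dη <• x)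
  η_dξ : η •> dξ = (r ^ 4)⁻¹ • (dξ <• η)
  η_dx : η •> dx = -((r ^ 2)⁻¹ • (dx <• η))
  η_dη : η •> dη = dη <• η

theorem diff_minusRelations (hr : r ≠ 0) :
    MinusRelations r (coord (r ^ 2) r 1) (coord (r ^ 2) r 0) (coord (r ^ 2) r 2) (diff hr (coord (r ^ 2) r 1))
      (diff hr (coord (r ^ 2) r 0)) (diff hr (coord (r ^ 2) r 2)) := by
  constructor
  all_goals
    ext i
    simp only [diff_coord, RightFreeForm.coeff_add, RightFreeForm.coeff_sub,
      RightFreeForm.coeff_smul, RightFreeForm.coeff_neg, RightFreeForm.coeff_left,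
      RightFreeForm.coeff_right, RightFreeForm.coeff_basis, leftRep_coord, Fin.sum_univ_three]
    fin_cases i
  all_goals simp [Point.val, Point.leftMatrix, point]

end SP

/-! ### Invariance of the commutation relations -/

theorem superTmul_mul_eq_zero {A B : Type*} [Ring A] [Algebra ℂ A] [SuperAlgebra A] [Ring B]
    [Algebra ℂ B] [SuperAlgebra B] (a a' : A) {b b' : B} (hb : parity b = b ∨ parity b = -b)
    (h : b * b' = 0) : a ⊗ˢ b * a' ⊗ˢ b' = 0 := by
  rcases hb with hb | hb
  · rw [superTmul_mul_even _ _ hb, h, superTmul_zero]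
  · rw [superTmul_mul_odd _ _ hb, h, superTmul_zero]

namespace SP

variable {r : ℂ}

section RelationsCovariant

variable {A B : Type*} [Ring A] [Algebra ℂ A] [SuperAlgebra A] [Ring B] [Algebra ℂ B]
  [SuperAlgebra B] {P : OSP.Point r A} {Y : Point r B}

set_option maxHeartbeats 8000000 in
/-- The relations of the second calculus are preserved by the action of `O(SP_q(1|2))`. -/
theorem MinusRelations.act (hr : r ≠ 0) (hP : P.Graded) (hY : Y.Graded) {dx dξ dη : B}
    (hx : parity dx = -dx) (hξ : parity dξ = dξ) (hη : parity dη = dη)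
    (h : MinusRelations r Y.x Y.ξ Y.η dx dξ dη) :
    MinusRelations r (Point.act hr P Y hP hY).x (Point.act hr P Y hP hY).ξ
      (Point.act hr P Y hP hY).η (P.e ⊗ˢ dx - P.γ ⊗ˢ dξ - P.β ⊗ˢ dη)
      (P.a ⊗ˢ dξ - P.α ⊗ˢ dx + P.b ⊗ˢ dη) (P.c ⊗ˢ dξ - P.δ ⊗ˢ dx + P.d ⊗ˢ dη) := by
  obtain ⟨h1, h2, h3, h4, h5, h6, h7, h8, h9⟩ := h
  -- Functions and forms lie in one superalgebra here, so both module actions are multiplications.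
  -- The relations then move every form to the left of a function, and the table for P treats the
  -- other tensor factor.
  simp only [smul_eq_mul, op_smul_eq_mul] at h1 h2 h3 h4 h5 h6 h7 h8 h9
  have hdξ := fun (a a' : A) (y : B) => superTmul_mul_even a a' hξ y
  have hdx := fun (a a' : A) (y : B) => superTmul_mul_odd a a' hx y
  have hdη := fun (a a' : A) (y : B) => superTmul_mul_even a a' hη y
  constructor
  all_goals
    simp only [smul_eq_mul, op_smul_eq_mul, Point.act, mul_add, add_mul, mul_sub, sub_mul,
      hY.superTmul_mul, hdξ, hdx, hdη, hP.a, hP.b, hP.c, hP.d, hP.e, hP.α, hP.β, hP.γ, hP.δ,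
      mul_neg]
    simp only [P.mul_table hr, h1, h2, h3, h4, h5, h6, h7, h8, h9, add_superTmul, superTmul_add,
      sub_superTmul, superTmul_sub, neg_superTmul, superTmul_neg, smul_superTmul, superTmul_smul]
  all_goals match_scalars
  all_goals try field_simp
  all_goals try ring

end RelationsCovariant
end SP

/-! ### The graded derivation τ ⊗ d -/

namespace SuperCalculus

variable {X : Type} [Ring X] [Algebra ℂ X] [SuperAlgebra X] (Γ : SuperCalculus X)

/-- Functions, as elements of the total algebra. -/
abbrev inlHom : X →ₐ[ℂ] Γ.Total := TrivSqZeroExt.inlAlgHom ℂ X Γ.Form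

/-- One-forms, as elements of the total algebra. -/
abbrev form (ω : Γ.Form) : Γ.Total := TrivSqZeroExt.inr ω

theorem inlHom_parity (u : X) : Γ.inlHom (parity u) = parity (Γ.inlHom u) := by
  change _ = TrivSqZeroExt.inl (parity u) + TrivSqZeroExt.inr (Γ.formParity 0)
  rw [map_zero, TrivSqZeroExt.inr_zero, add_zero]
  rfl

theorem parity_form (ω : Γ.Form) : parity (Γ.form ω) = Γ.form (Γ.formParity ω) := by
  change TrivSqZeroExt.inl (parity (0 : X)) + TrivSqZeroExt.inr (Γ.formParity ω) = _
  rw [map_zero, TrivSqZeroExt.inl_zero, zero_add]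

theorem inlHom_mul_form (u : X) (ω : Γ.Form) : Γ.inlHom u * Γ.form ω = Γ.form (u •> ω) :=
  TrivSqZeroExt.inl_mul_inr u ω

theorem form_mul_inlHom (u : X) (ω : Γ.Form) : Γ.form ω * Γ.inlHom u = Γ.form (ω <• u) :=
  TrivSqZeroExt.inr_mul_inl u ω

theorem form_mul_form (ω ω' : Γ.Form) : Γ.form ω * Γ.form ω' = 0 := TrivSqZeroExt.inr_mul_inr X ω ω'

theorem d_one : Γ.d 1 = 0 := by
  have h := Γ.leibniz 1 1
  rw [map_one parity, MulOpposite.op_one, one_smul, one_smul, mul_one] at h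
  exact left_eq_add.1 h

variable {A : Type*} [Ring A] [Algebra ℂ A] [SuperAlgebra A]

/-- The map `τ ⊗ d`. -/
def twistedDiff : SuperTensor A X →ₗ[ℂ] SuperTensor A Γ.Total :=
  (superOf A Γ.Total).toLinearMap ∘ₗ
    TensorProduct.map (parity (A := A)).toLinearMap Γ.dTotal ∘ₗ (superOf A X).symm.toLinearMap

theorem twistedDiff_tmul (a : A) (u : X) :
    Γ.twistedDiff (a ⊗ˢ u) = parity a ⊗ˢ Γ.form (Γ.d u) := rfl

/-- The twist τ is the sign for moving the odd map d past the first tensor factor. With it τ ⊗ d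
becomes a graded derivation, so its composite with the coaction is controlled by the coordinates. -/
theorem twistedDiff_mul (z w : SuperTensor A X) :
    Γ.twistedDiff (z * w) =
      Γ.twistedDiff z * superMap (AlgHom.id ℂ A) Γ.inlHom algHom_id_parity Γ.inlHom_parity w +
      superMap (AlgHom.id ℂ A) Γ.inlHom algHom_id_parity Γ.inlHom_parity (parity z) *
        Γ.twistedDiff w := by
  induction w using superTensor_induction' with
  | add w w' hw hw' => simp only [mul_add, map_add, hw, hw']; abel
  | tmul b v =>
    induction z using superTensor_induction with
    | add z z' hz hz' => simp only [add_mul, map_add, hz, hz']; abel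
    | even a u hu =>
      have h1 : parity (Γ.form (Γ.d u)) = -Γ.form (Γ.d u) := by
        rw [parity_form, Γ.formParity_d, hu]
        exact TrivSqZeroExt.inr_neg X _
      have h2 : parity (Γ.inlHom u) = Γ.inlHom u := by rw [← inlHom_parity, hu]
      rw [superTmul_mul_even _ _ hu, parity_superTmul, hu]
      simp only [twistedDiff_tmul, superMap_tmul, AlgHom.id_apply]
      rw [superTmul_mul_odd _ _ h1, superTmul_mul_even _ _ h2, form_mul_inlHom, inlHom_mul_form,
        ← map_mul, ← superTmul_add, Γ.leibniz, hu]
      exact congrArg _ (TrivSqZeroExt.inr_add X _ _)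
    | odd a u hu =>
      have h1 : parity (Γ.form (Γ.d u)) = Γ.form (Γ.d u) := by
        rw [parity_form, Γ.formParity_d, hu, map_neg, neg_neg]
      have h2 : parity (Γ.inlHom u) = -Γ.inlHom u := by rw [← inlHom_parity, hu, map_neg]
      rw [superTmul_mul_odd _ _ hu, parity_superTmul, hu]
      simp only [twistedDiff_tmul, superMap_tmul, AlgHom.id_apply, map_neg, superTmul_neg, neg_mul]
      rw [superTmul_mul_even _ _ h1, superTmul_mul_odd _ _ h2, form_mul_inlHom, inlHom_mul_form,
        map_mul, parity_parity, ← superTmul_neg, ← superTmul_add, Γ.leibniz, hu, neg_smul]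
      refine congrArg _ ((TrivSqZeroExt.inr_add X _ _).trans ?_)
      rw [TrivSqZeroExt.inr_neg]

end SuperCalculus

/-! ### The coaction on functions and one-forms -/

namespace SP

variable {r : ℂ} (Γ : SuperCalculus (Alg (r ^ 2) r))

/-- The coordinates, as elements of the total algebra of a calculus. -/
def totalPoint : Point r Γ.Total where
  ξ := Γ.inlHom (point r).ξ
  x := Γ.inlHom (point r).x
  η := Γ.inlHom (point r).η
  x_xi := by rw [← map_mul, (point r).x_xi, map_smul, map_mul]
  x_eta := by rw [← map_mul, (point r).x_eta, map_smul, map_mul]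
  eta_xi := by simp only [← map_mul, (point r).eta_xi, map_smul, map_add, map_neg]
  xi_xi := by rw [← map_mul, (point r).xi_xi, map_zero]
  eta_eta := by rw [← map_mul, (point r).eta_eta, map_zero]

theorem graded_totalPoint : (totalPoint Γ).Graded where
  ξ := by simp only [totalPoint, ← Γ.inlHom_parity, (graded_point r).ξ, map_neg]
  x := by simp only [totalPoint, ← Γ.inlHom_parity, (graded_point r).x]
  η := by simp only [totalPoint, ← Γ.inlHom_parity, (graded_point r).η, map_neg]

theorem totalPoint_val (i : Fin 3) : (totalPoint Γ).val i = Γ.inlHom (coord _ r i) := by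
  fin_cases i <;> rfl

/-- The coaction on functions, with values in the total algebra of a calculus. -/
def totalCoact (hr : r ≠ 0) : Alg (r ^ 2) r →ₐ[ℂ] SuperTensor (OSP.Alg (r ^ 2) r) Γ.Total :=
  (Point.act hr (OSP.point r) (totalPoint Γ) (OSP.graded_point r) (graded_totalPoint Γ)).lift

theorem totalCoact_coord (hr : r ≠ 0) (i : Fin 3) :
    totalCoact Γ hr (coord _ r i) =
      ∑ k, (OSP.point r).matrix i k ⊗ˢ Γ.inlHom (coord _ r k) := by
  rw [totalCoact, Point.lift_coord, Point.act_val]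
  simp only [totalPoint_val]

/-- Identifies the coaction built inside the total algebra with the original one followed by the
inclusion of functions; both are homomorphisms and agree on coordinates. -/
theorem superMap_coactHom (hr : r ≠ 0) (u : Alg (r ^ 2) r) :
    superMap (AlgHom.id ℂ _) Γ.inlHom algHom_id_parity Γ.inlHom_parity (coactHom hr u) =
      totalCoact Γ hr u := by
  refine DFunLike.congr_fun (AlgHom.ext_of_adjoin_eq_top
    (φ₁ := (superMap (AlgHom.id ℂ _) Γ.inlHom algHom_id_parity Γ.inlHom_parity).comp (coactHom hr))
    (φ₂ := totalCoact Γ hr) (adjoin_coord_eq_top _ r) ?_) u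
  rintro _ ⟨i, rfl⟩
  simp only [AlgHom.comp_apply, coactHom_coord, totalCoact_coord, map_sum, superMap_tmul,
    AlgHom.id_apply]

/-- The coaction on the differentials of the coordinates. -/
def formCoact (i : Fin 3) : SuperTensor (OSP.Alg (r ^ 2) r) Γ.Total :=
  ∑ k, (sign i * sign k) • ((OSP.point r).matrix i k ⊗ˢ Γ.form (Γ.d (coord _ r k)))

/-- This expansion and the next two put the coaction on differentials into the shape required by
`MinusRelations.act`; the minus signs are the effect of τ on odd matrix entries. -/
theorem formCoact_zero : formCoact Γ 0 = (OSP.point r).a ⊗ˢ Γ.form (Γ.d (coord _ r 0)) -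
    (OSP.point r).α ⊗ˢ Γ.form (Γ.d (coord _ r 1)) +
    (OSP.point r).b ⊗ˢ Γ.form (Γ.d (coord _ r 2)) := by
  simp [formCoact, Fin.sum_univ_three, sign, OSP.Point.matrix]
  abel

theorem formCoact_one : formCoact Γ 1 = (OSP.point r).e ⊗ˢ Γ.form (Γ.d (coord _ r 1)) -
    (OSP.point r).γ ⊗ˢ Γ.form (Γ.d (coord _ r 0)) -
    (OSP.point r).β ⊗ˢ Γ.form (Γ.d (coord _ r 2)) := by
  simp [formCoact, Fin.sum_univ_three, sign, OSP.Point.matrix]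
  abel

theorem formCoact_two : formCoact Γ 2 = (OSP.point r).c ⊗ˢ Γ.form (Γ.d (coord _ r 0)) -
    (OSP.point r).δ ⊗ˢ Γ.form (Γ.d (coord _ r 1)) +
    (OSP.point r).d ⊗ˢ Γ.form (Γ.d (coord _ r 2)) := by
  simp [formCoact, Fin.sum_univ_three, sign, OSP.Point.matrix]
  abel

theorem parity_form_d_coord (i : Fin 3) : parity (Γ.form (Γ.d (coord _ r i))) =
    -sign i • Γ.form (Γ.d (coord _ r i)) := by
  rw [Γ.parity_form, Γ.formParity_d, parity_coord, map_smul, ← neg_smul]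
  exact TrivSqZeroExt.inr_smul _ _ _

theorem formCoact_mul_formCoact (i j : Fin 3) : formCoact Γ i * formCoact Γ j = 0 := by
  rw [formCoact, formCoact, Finset.sum_mul_sum]
  refine Finset.sum_eq_zero fun k _ => Finset.sum_eq_zero fun l _ => ?_
  rw [smul_mul_smul_comm, superTmul_mul_eq_zero _ _ _ (Γ.form_mul_form _ _), smul_zero]
  rw [parity_form_d_coord]
  fin_cases k <;> simp [sign]

/-- The relations of the second calculus, in the total algebra. -/
theorem formCoact_relations (hr : r ≠ 0)
    (h : MinusRelations r (coord (r ^ 2) r 1) (coord (r ^ 2) r 0) (coord (r ^ 2) r 2)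
      (Γ.d (coord (r ^ 2) r 1)) (Γ.d (coord (r ^ 2) r 0)) (Γ.d (coord (r ^ 2) r 2))) :
    MinusRelations r (totalCoact Γ hr (coord _ r 1)) (totalCoact Γ hr (coord _ r 0))
      (totalCoact Γ hr (coord _ r 2)) (formCoact Γ 1) (formCoact Γ 0) (formCoact Γ 2) := by
  have hd := parity_form_d_coord Γ
  rw [formCoact_zero, formCoact_one, formCoact_two, totalCoact, Point.lift_coord,
    Point.lift_coord, Point.lift_coord]
  refine MinusRelations.act hr (OSP.graded_point r) (graded_totalPoint Γ) ?_ ?_ ?_ ?_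
  · simpa [sign] using hd 1
  · simpa [sign] using hd 0
  · simpa [sign] using hd 2
  · have hadd : ∀ ω ω', Γ.form (ω + ω') = Γ.form ω + Γ.form ω' := TrivSqZeroExt.inr_add _
    have hsub : ∀ ω ω', Γ.form (ω - ω') = Γ.form ω - Γ.form ω' := TrivSqZeroExt.inr_sub _
    have hneg : ∀ ω, Γ.form (-ω) = -Γ.form ω := TrivSqZeroExt.inr_neg _
    have hsmul : ∀ (c : ℂ) ω, Γ.form (c • ω) = c • Γ.form ω := TrivSqZeroExt.inr_smul _
    obtain ⟨h1, h2, h3, h4, h5, h6, h7, h8, h9⟩ := h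
    constructor <;>
      simp only [smul_eq_mul, op_smul_eq_mul, totalPoint, Γ.inlHom_mul_form, Γ.form_mul_inlHom,
        point, h1, h2, h3, h4, h5, h6, h7, h8, h9, hadd, hsub, hneg, hsmul]

/-- The coaction on one-forms determined by the coaction on the basis of differentials. -/
def formHom (hr : r ≠ 0) (b : Module.Basis (Fin 3) (Alg (r ^ 2) r)ᵐᵒᵖ Γ.Form) :
    Γ.Form →ₗ[ℂ] SuperTensor (OSP.Alg (r ^ 2) r) Γ.Total where
  -- This formula is forced by multiplicativity, and freeness makes the coefficients unique, hence
  -- the map well defined.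
  toFun ω := ∑ i, formCoact Γ i * totalCoact Γ hr (b.repr ω i).unop
  map_add' ω ω' := by
    simp only [map_add, Finsupp.add_apply, MulOpposite.unop_add, mul_add, Finset.sum_add_distrib]
  map_smul' c ω := by
    have h : b.repr (c • ω) = (c • (1 : (Alg (r ^ 2) r)ᵐᵒᵖ)) • b.repr ω := by
      rw [← map_smul, smul_assoc, one_smul]
    simp only [h, Finsupp.smul_apply, smul_assoc, one_smul, MulOpposite.unop_smul, map_smul,
      mul_smul_comm, Finset.smul_sum, RingHom.id_apply]

section Covariance

variable {Γ} (hr : r ≠ 0) {b : Module.Basis (Fin 3) (Alg (r ^ 2) r)ᵐᵒᵖ Γ.Form}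

theorem formHom_apply (ω : Γ.Form) : formHom Γ hr b ω =
    ∑ i, formCoact Γ i * totalCoact Γ hr (b.repr ω i).unop := rfl

theorem formHom_right (ω : Γ.Form) (u : Alg (r ^ 2) r) :
    formHom Γ hr b (ω <• u) = formHom Γ hr b ω * totalCoact Γ hr u := by
  rw [formHom_apply, formHom_apply]
  simp only [map_smul, Finsupp.smul_apply, smul_eq_mul, MulOpposite.unop_mul, MulOpposite.unop_op,
    map_mul, Finset.sum_mul, mul_assoc]

theorem formHom_basis (i : Fin 3) : formHom Γ hr b (b i) = formCoact Γ i := by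
  rw [formHom_apply, Finset.sum_eq_single i]
  · rw [b.repr_self, Finsupp.single_eq_same, MulOpposite.unop_one, map_one, mul_one]
  · intro j _ hj
    rw [b.repr_self, Finsupp.single_eq_of_ne hj, MulOpposite.unop_zero, map_zero, mul_zero]
  · exact fun h => absurd (Finset.mem_univ i) h

theorem sum_basis_smul (ω : Γ.Form) : ω = ∑ i, b i <• (b.repr ω i).unop := (b.sum_repr ω).symm

/-- The commutation relations enter here. As left and right actions commute, it is enough to let a
coordinate act on a basis form. The relations of Γ and their transformed versions from
`formCoact_relations` have identical coefficients, so both sides expand equally. -/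
theorem formHom_left
    (hb : ∀ i, b i = Γ.d (coord _ r i))
    (h : MinusRelations r (coord (r ^ 2) r 1) (coord (r ^ 2) r 0) (coord (r ^ 2) r 2)
      (Γ.d (coord (r ^ 2) r 1)) (Γ.d (coord (r ^ 2) r 0)) (Γ.d (coord (r ^ 2) r 2)))
    (u : Alg (r ^ 2) r) (ω : Γ.Form) :
    formHom Γ hr b (u •> ω) = totalCoact Γ hr u * formHom Γ hr b ω := by
  induction u using SP.induction generalizing ω with
  | coord i =>
    rw [sum_basis_smul (b := b) ω]
    simp only [Finset.smul_sum, map_sum, Finset.mul_sum]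
    refine Finset.sum_congr rfl fun j _ => ?_
    rw [smul_comm, formHom_right, formHom_right, ← mul_assoc]
    congr 1
    have hbasis : ∀ k, formHom Γ hr b (Γ.d (coord _ r k)) = formCoact Γ k := fun k => by
      rw [← hb, formHom_basis]
    obtain ⟨k1, k2, k3, k4, k5, k6, k7, k8, k9⟩ := formCoact_relations Γ hr h
    simp only [smul_eq_mul, op_smul_eq_mul] at k1 k2 k3 k4 k5 k6 k7 k8 k9
    obtain ⟨h1, h2, h3, h4, h5, h6, h7, h8, h9⟩ := h
    rw [hb, hbasis]
    fin_cases i <;> fin_cases j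
    all_goals
      simp only [Fin.zero_eta, Fin.mk_one, Fin.reduceFinMk, h1, h2, h3, h4, h5, h6, h7, h8, h9,
        k1, k2, k3, k4, k5, k6, k7, k8, k9, map_add, map_sub, map_neg, map_smul, formHom_right,
        hbasis]
  | algebraMap c => rw [AlgHom.commutes, algebraMap_smul, map_smul, Algebra.smul_def]
  | add u v hu hv => rw [add_smul, map_add, map_add, add_mul, hu, hv]
  | mul u v hu hv => rw [mul_smul, hu, hv, map_mul, mul_assoc]

/-- Left linearity absorbs the function between two differentials into the second form; expanding
that form in the basis leaves products of two transformed differentials, which vanish. -/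
theorem formHom_mul_formHom
    (hb : ∀ i, b i = Γ.d (coord _ r i))
    (h : MinusRelations r (coord (r ^ 2) r 1) (coord (r ^ 2) r 0) (coord (r ^ 2) r 2)
      (Γ.d (coord (r ^ 2) r 1)) (Γ.d (coord (r ^ 2) r 0)) (Γ.d (coord (r ^ 2) r 2)))
    (ω ω' : Γ.Form) : formHom Γ hr b ω * formHom Γ hr b ω' = 0 := by
  rw [formHom_apply _ ω, Finset.sum_mul]
  refine Finset.sum_eq_zero fun i _ => ?_
  rw [mul_assoc, ← formHom_left hr hb h, formHom_apply, Finset.mul_sum]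
  refine Finset.sum_eq_zero fun j _ => ?_
  rw [← mul_assoc, formCoact_mul_formCoact, zero_mul]

/-- The coaction on functions and one-forms, as an algebra homomorphism. -/
def totalHom
    (hb : ∀ i, b i = Γ.d (coord _ r i))
    (h : MinusRelations r (coord (r ^ 2) r 1) (coord (r ^ 2) r 0) (coord (r ^ 2) r 2)
      (Γ.d (coord (r ^ 2) r 1)) (Γ.d (coord (r ^ 2) r 0)) (Γ.d (coord (r ^ 2) r 2))) :
    Γ.Total →ₐ[ℂ] SuperTensor (OSP.Alg (r ^ 2) r) Γ.Total :=
  TrivSqZeroExt.lift (totalCoact Γ hr) (formHom Γ hr b) (formHom_mul_formHom hr hb h)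
    (formHom_left hr hb h) (fun u ω => formHom_right hr ω u)

theorem totalHom_inl
    (hb : ∀ i, b i = Γ.d (coord _ r i))
    (h : MinusRelations r (coord (r ^ 2) r 1) (coord (r ^ 2) r 0) (coord (r ^ 2) r 2)
      (Γ.d (coord (r ^ 2) r 1)) (Γ.d (coord (r ^ 2) r 0)) (Γ.d (coord (r ^ 2) r 2)))
    (u : Alg (r ^ 2) r) : totalHom hr hb h (Γ.inlHom u) = totalCoact Γ hr u :=
  TrivSqZeroExt.lift_apply_inl _ _ _ _ _ u

theorem totalHom_form
    (hb : ∀ i, b i = Γ.d (coord _ r i))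
    (h : MinusRelations r (coord (r ^ 2) r 1) (coord (r ^ 2) r 0) (coord (r ^ 2) r 2)
      (Γ.d (coord (r ^ 2) r 1)) (Γ.d (coord (r ^ 2) r 0)) (Γ.d (coord (r ^ 2) r 2)))
    (ω : Γ.Form) : totalHom hr hb h (Γ.form ω) = formHom Γ hr b ω :=
  TrivSqZeroExt.lift_apply_inr _ _ _ _ _ ω

theorem totalHom_form_d_coord
    (hb : ∀ i, b i = Γ.d (coord _ r i))
    (h : MinusRelations r (coord (r ^ 2) r 1) (coord (r ^ 2) r 0) (coord (r ^ 2) r 2)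
      (Γ.d (coord (r ^ 2) r 1)) (Γ.d (coord (r ^ 2) r 0)) (Γ.d (coord (r ^ 2) r 2)))
    (i : Fin 3) : totalHom hr hb h (Γ.form (Γ.d (coord _ r i))) = formCoact Γ i := by
  rw [totalHom_form, ← hb, formHom_basis]

/-- Coordinates and their differentials generate, because every form is a right combination of the
basis. The quantum space axioms on the total algebra thus become statements about six elements. -/
theorem adjoin_total_eq_top (hb : ∀ i, b i = Γ.d (coord _ r i)) :
    Algebra.adjoin ℂ (Set.range (fun i => Γ.inlHom (coord _ r i)) ∪
      Set.range fun i => Γ.form (Γ.d (coord _ r i))) = ⊤ := by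
  set s := Set.range (fun i => Γ.inlHom (coord _ r i)) ∪
    Set.range fun i => Γ.form (Γ.d (coord _ r i)) with hs
  have hinl : ∀ u, Γ.inlHom u ∈ Algebra.adjoin ℂ s := fun u => by
    induction u using SP.induction with
    | coord i => exact Algebra.subset_adjoin (Or.inl ⟨i, rfl⟩)
    | algebraMap c =>
      rw [AlgHom.commutes]
      exact Subalgebra.algebraMap_mem _ c
    | add u v hu hv => rw [map_add]; exact add_mem hu hv
    | mul u v hu hv => rw [map_mul]; exact mul_mem hu hv
  refine Algebra.eq_top_iff.2 fun t => ?_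
  rw [← TrivSqZeroExt.inl_fst_add_inr_snd_eq t]
  refine add_mem (hinl t.fst) ?_
  rw [sum_basis_smul (b := b) t.snd, TrivSqZeroExt.inr_sum]
  refine sum_mem fun i _ => ?_
  change Γ.form _ ∈ _
  rw [← Γ.form_mul_inlHom, hb]
  exact mul_mem (Algebra.subset_adjoin (Or.inr ⟨i, rfl⟩)) (hinl _)

theorem totalHom_parity
    (hb : ∀ i, b i = Γ.d (coord _ r i))
    (h : MinusRelations r (coord (r ^ 2) r 1) (coord (r ^ 2) r 0) (coord (r ^ 2) r 2)
      (Γ.d (coord (r ^ 2) r 1)) (Γ.d (coord (r ^ 2) r 0)) (Γ.d (coord (r ^ 2) r 2)))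
    (t : Γ.Total) : totalHom hr hb h (parity t) = parity (totalHom hr hb h t) := by
  refine coact_parity_of_adjoin_eq_top (adjoin_total_eq_top hb) ?_ t
  rintro _ (⟨i, rfl⟩ | ⟨i, rfl⟩)
  · simp only [← Γ.inlHom_parity, totalHom_inl, ← superMap_coactHom, coactHom_parity]
    generalize coactHom hr (coord _ r i) = z
    induction z using superTensor_induction' with
    | add z w hz hw => simp only [map_add, hz, hw]
    | tmul a u =>
      simp only [parity_superTmul, superMap_tmul, AlgHom.id_apply, ← Γ.inlHom_parity]
  · simp only [parity_form_d_coord, map_smul, totalHom_form_d_coord]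
    rw [formCoact]
    simp only [(OSP.graded_point r).matrix, parity_form_d_coord, map_sum, map_smul,
      parity_superTmul, smul_superTmul, superTmul_smul, smul_smul, Finset.smul_sum]
    refine Finset.sum_congr rfl fun k _ => ?_
    congr 1
    linear_combination (sign i * sign i * sign k) * OSP.sign_mul_sign k

end Covariance

end SP

/-! ### Left covariance of the calculus -/

namespace SP

variable {r : ℂ} {Γ : SuperCalculus (Alg (r ^ 2) r)}
  {b : Module.Basis (Fin 3) (Alg (r ^ 2) r)ᵐᵒᵖ Γ.Form}

/-- The structure of left quantum space on functions and one-forms. -/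
def totalQuantumSpace (hr : r ≠ 0) (hb : ∀ i, b i = Γ.d (coord _ r i))
    (h : MinusRelations r (coord (r ^ 2) r 1) (coord (r ^ 2) r 0) (coord (r ^ 2) r 2)
      (Γ.d (coord (r ^ 2) r 1)) (Γ.d (coord (r ^ 2) r 0)) (Γ.d (coord (r ^ 2) r 2))) :
    LeftQuantumSpace (OSP.hopf hr) Γ.Total :=
  LeftQuantumSpace.ofGenerators (OSP.hopf hr) (totalHom hr hb h) (adjoin_total_eq_top hb)
    (totalHom_parity hr hb h)
    (by
      rintro _ (⟨i, rfl⟩ | ⟨i, rfl⟩)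
      · simp only [totalHom_inl, totalCoact_coord, map_sum, superMap_tmul, AlgHom.id_apply,
          OSP.hopf_comulHom, OSP.comulHom_matrix, Fin.sum_univ_three, add_superTmul,
          superTmul_add, map_add, superAssoc_tmul]
        abel
      -- Two successive coactions give the sign (s_i s_k)(s_k s_l) = s_i s_l, independent of the
      -- middle index, so the coassociativity for T carries over.
      · simp only [totalHom_form_d_coord, formCoact, map_sum, map_smul, superMap_tmul,
          AlgHom.id_apply, OSP.hopf_comulHom, OSP.comulHom_matrix, Fin.sum_univ_three,
          add_superTmul, superTmul_add, superTmul_smul, map_add, superAssoc_tmul, smul_add,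
          smul_smul, sign, Matrix.cons_val_zero, Matrix.cons_val_one, Matrix.cons_val]
        module)
    (by
      rintro _ (⟨i, rfl⟩ | ⟨i, rfl⟩)
      · simp only [totalHom_inl, totalCoact_coord, map_sum, superLid_tmul, OSP.hopf_counitHom,
          OSP.counitHom_matrix, ite_smul, one_smul, zero_smul, Finset.sum_ite_eq,
          Finset.mem_univ, if_true]
      · simp only [totalHom_form_d_coord, formCoact, map_sum, map_smul, superLid_tmul,
          OSP.hopf_counitHom, OSP.counitHom_matrix, ite_smul, one_smul, zero_smul, smul_ite,
          smul_zero, Finset.sum_ite_eq, Finset.mem_univ, if_true, OSP.sign_mul_sign])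

/-- Both sides satisfy the same graded Leibniz rule along the coaction on functions, so agreement on
coordinates and scalars is enough. -/
theorem twistedDiff_coactHom (hr : r ≠ 0) (hb : ∀ i, b i = Γ.d (coord _ r i))
    (h : MinusRelations r (coord (r ^ 2) r 1) (coord (r ^ 2) r 0) (coord (r ^ 2) r 2)
      (Γ.d (coord (r ^ 2) r 1)) (Γ.d (coord (r ^ 2) r 0)) (Γ.d (coord (r ^ 2) r 2)))
    (u : Alg (r ^ 2) r) : formHom Γ hr b (Γ.d u) = Γ.twistedDiff (coactHom hr u) := by
  induction u using SP.induction with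
  | coord i =>
    rw [← hb, formHom_basis, coactHom_coord, formCoact]
    simp only [map_sum, SuperCalculus.twistedDiff_tmul, (OSP.graded_point r).matrix, smul_superTmul]
  | algebraMap c =>
    rw [AlgHom.commutes, Algebra.algebraMap_eq_smul_one, Algebra.algebraMap_eq_smul_one, map_smul,
      map_smul, map_smul, Γ.d_one, map_zero, ← one_superTmul_one, Γ.twistedDiff_tmul, Γ.d_one]
    exact congrArg _ ((superTmul_zero _).symm)
  | add u v hu hv => rw [map_add, map_add, map_add, map_add, hu, hv]
  | mul u v hu hv =>
    rw [Γ.leibniz, map_add, formHom_right, formHom_left hr hb h, hu, hv, map_mul,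
      Γ.twistedDiff_mul, superMap_coactHom, ← coactHom_parity, superMap_coactHom]

/-- A calculus with the commutation relations of `Γ₋`, free as a right module on the differentials
of the coordinates, is left covariant. -/
theorem isLeftCovariant_of_minusRelations (hr : r ≠ 0) (hb : ∀ i, b i = Γ.d (coord _ r i))
    (h : MinusRelations r (coord (r ^ 2) r 1) (coord (r ^ 2) r 0) (coord (r ^ 2) r 2)
      (Γ.d (coord (r ^ 2) r 1)) (Γ.d (coord (r ^ 2) r 0)) (Γ.d (coord (r ^ 2) r 2))) :
    Γ.IsLeftCovariant (coaction hr) := by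
  refine ⟨totalQuantumSpace hr hb h, fun u => ?_, fun u => ?_⟩
  · exact (totalHom_inl hr hb h u).trans (superMap_coactHom Γ hr u).symm
  · exact (totalHom_form hr hb h (Γ.d u)).trans (twistedDiff_coactHom hr hb h u)

/-! ### The substituted relations and the comparison with Γ₊ -/

/-- The relations of the second calculus are those of the first one after the substitution
`q → q⁻¹`, `x → √-1 x`, `ξ ↔ η`. -/
theorem MinusRelations.calculusRelations {X Γ : Type*} [Ring X] [Algebra ℂ X] [AddCommGroup Γ]
    [Module ℂ Γ] [Module X Γ] [Module Xᵐᵒᵖ Γ] [IsScalarTower ℂ X Γ] [IsScalarTower ℂ Xᵐᵒᵖ Γ]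
    (hr : r ≠ 0) {x ξ η : X} {dx dξ dη : Γ} (h : MinusRelations r x ξ η dx dξ dη) :
    CalculusRelations (r ^ 2)⁻¹ r⁻¹ (Complex.I • x) η ξ (Complex.I • dx) dη dξ := by
  have hI : ∀ ω : Γ, Complex.I • Complex.I • ω = -ω := fun ω => by
    rw [smul_smul, Complex.I_mul_I, neg_one_smul]
  have hl : ∀ (c : ℂ) (u : X) (ω : Γ), u •> (c • ω) = c • (u •> ω) := fun c u ω => smul_comm u c ω
  have hr' : ∀ (c : ℂ) (u : X) (ω : Γ), (c • ω) <• u = c • (ω <• u) := fun c u ω =>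
    smul_comm _ c ω
  obtain ⟨h1, h2, h3, h4, h5, h6, h7, h8, h9⟩ := h
  refine ⟨?_, ?_, ?_, ?_, ?_, ?_, ?_, ?_, ?_⟩
  all_goals
    simp only [smul_assoc, MulOpposite.op_smul, hl, hr', hI, h1, h2, h3, h4, h5, h6, h7, h8, h9]
  all_goals
    -- The nine products become independent symbols, so that only coefficients are compared.
    generalize dξ <• ξ = a₁
    generalize dξ <• x = a₂
    generalize dξ <• η = a₃
    generalize dx <• ξ = a₄
    generalize dx <• x = a₅
    generalize dx <• η = a₆
    generalize dη <• ξ = a₇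
    generalize dη <• x = a₈
    generalize dη <• η = a₉
    match_scalars
  all_goals try field_simp
  all_goals try ring

/-- With ξ and x sent to 0, the only relation left to respect is η² = 0, and the dual numbers
realise it with a nonzero η. -/
theorem coord_two_ne_zero (r : ℂ) : coord (r ^ 2) r 2 ≠ 0 := by
  let Y : Point r (DualNumber ℂ) :=
    { ξ := 0
      x := 0
      η := DualNumber.eps
      x_xi := by simp
      x_eta := by simp
      eta_xi := by simp
      xi_xi := by simp
      eta_eta := DualNumber.eps_mul_eps }
  intro h
  have h' := congrArg Y.lift h
  rw [Point.lift_coord, map_zero] at h'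
  exact one_ne_zero (congrArg TrivSqZeroExt.snd h')

/-- The hypothesis has the shape of two competing expressions for x · dη. Its dx-coefficient reads
c₁ η = 0, and η is nonzero. -/
theorem eq_zero_of_smul_basis_eq (hr : r ≠ 0) {c₁ c₂ c₃ : ℂ}
    (h : (c₁ • (diff hr (coord (r ^ 2) r 1) <• coord (r ^ 2) r 2) +
        c₂ • (diff hr (coord (r ^ 2) r 2) <• coord (r ^ 2) r 1) : RightFreeForm (leftRep hr)) =
      c₃ • (diff hr (coord (r ^ 2) r 2) <• coord (r ^ 2) r 1)) : c₁ = 0 := by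
  rw [diff_coord, diff_coord] at h
  have h' := congrArg (fun ω : RightFreeForm (leftRep hr) => ω.coeff 1) h
  simp only [RightFreeForm.coeff_add, RightFreeForm.coeff_smul, RightFreeForm.coeff_right,
    RightFreeForm.coeff_basis] at h'
  simpa [coord_two_ne_zero] using h'

end SP

end

theorem corollary1 (q r : ℂ) (hq : q ≠ 0) (hr : r ^ 2 = q) :
    ∃ (H : SuperHopfAlgebra (OSP.Alg q r)) (δ : LeftQuantumSpace H (SP.Alg q r)),
      OSP.IsStandard H ∧ OSP.IsStandardCoaction δ ∧
      ∃ Γ : SuperCalculus (SP.Alg q r),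
        let ξ := SP.coord q r 0
        let x := SP.coord q r 1
        let η := SP.coord q r 2
        Γ.IsLeftCovariant δ ∧
        LinearIndependent (SP.Alg q r)ᵐᵒᵖ ![Γ.d x, Γ.d ξ, Γ.d η] ∧
        Submodule.span (SP.Alg q r)ᵐᵒᵖ (Set.range ![Γ.d x, Γ.d ξ, Γ.d η]) = ⊤ ∧
        CalculusRelations q⁻¹ r⁻¹ (Complex.I • x) η ξ
          (Complex.I • Γ.d x) (Γ.d η) (Γ.d ξ) ∧
        (q ^ 2 ≠ 1 → ¬ CalculusRelations q r x ξ η (Γ.d x) (Γ.d ξ) (Γ.d η)) := by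
  subst hr
  have hr : r ≠ 0 := fun h => hq (by rw [h, zero_pow two_ne_zero])
  have hb := SP.minusBasis_apply hr
  have hrel : SP.MinusRelations r (SP.coord (r ^ 2) r 1) (SP.coord (r ^ 2) r 0)
      (SP.coord (r ^ 2) r 2) ((SP.minusCalculus hr).d (SP.coord (r ^ 2) r 1))
      ((SP.minusCalculus hr).d (SP.coord (r ^ 2) r 0))
      ((SP.minusCalculus hr).d (SP.coord (r ^ 2) r 2)) := SP.diff_minusRelations hr
  -- The statement lists dx first, whereas the basis is indexed in the order ξ, x, η; hence the
  -- transposition.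
  have hv : ![(SP.minusCalculus hr).d (SP.coord (r ^ 2) r 1),
      (SP.minusCalculus hr).d (SP.coord (r ^ 2) r 0),
      (SP.minusCalculus hr).d (SP.coord (r ^ 2) r 2)] =
      SP.minusBasis hr ∘ Equiv.swap (0 : Fin 3) 1 := by
    ext i
    rw [Function.comp_apply, hb]
    fin_cases i <;> rfl
  refine ⟨OSP.hopf hr, SP.coaction hr, OSP.isStandard_hopf hr, SP.isStandardCoaction_coaction hr,
    SP.minusCalculus hr, SP.isLeftCovariant_of_minusRelations hr hb hrel, ?_, ?_,
    hrel.calculusRelations hr, ?_⟩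
  · rw [hv]
    exact (SP.minusBasis hr).linearIndependent.comp _ (Equiv.injective _)
  · rw [hv, EquivLike.range_comp]
    exact (SP.minusBasis hr).span_eq
  · intro hq2 hplus
    -- This is the relation for x · dη, which in Γ₊ has no dx · η term. Equating it with the
    -- relation of Γ₋ forces q⁻² - 1 = 0.
    have h1 := hplus.2.2.1
    rw [hrel.x_dη] at h1
    have h2 := SP.eq_zero_of_smul_basis_eq hr h1
    apply hq2
    rw [sub_eq_zero, inv_eq_one] at h2
    rw [← pow_mul, h2]
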